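/- **Theorem 1 (Single-Tier).** *Network.* Fix $a>0$ and $0\le\delta<\tfrac{\sqrt3}{2}a$. For $L\ge 1$ consider a hexagonal cell of side length $a$ together with the $L$ rings of hexagonal cells around it, $n=3L(L+1)+1$ cells in all. Each cell contains exactly one node, at distance at most $\delta$ from the centre of the cell ($\delta=0$: regular network; $\delta>0$: randomly perturbed network, in which the positions may be random with an arbitrary joint law). Two nodes are $l$ rings apart if their cells are $l$ hops apart in the hexagonal tiling. Every node chooses, independently and uniformly, one of the other $n-1$ nodes as its destination. *Transmission.* Let $r=r_L$ be an integer, $1\le r\le L$ for all large $L$ (the transmission range in rings). All nodes use the power $P=P^0 d_{\max}^{\alpha}/G$, where $P^0,G>0$ and the path loss exponent $\alpha$ are constants and $d_{\max}$ is the largest distance between two nodes at most $r$ rings apart. Node $j$ receives power $G P d_{ij}^{-\alpha}$ from a node $i$ at distance $d_{ij}$, and if $A$ is the set of transmitting nodes, then $i\in A$ transmits to $j$ at rate $W\log_2(1+\gamma_{ij})$, $\gamma_{ij}=GPd_{ij}^{-\alpha}/(\eta+\sum_{k\in A\setminus\{i\}}GPd_{kj}^{-\alpha})$, where $W>0$ is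 the bandwidth and $\eta>0$ the constant noise power. Time is divided into equal slots, with a periodic schedule; in each slot a node is silent or sends data of one flow to one other node at most $r$ rings away, and whenever $i$ transmits to $j$, all nodes at most $r$ rings away from $j$ (including $j$) other than $i$ are silent. A per-node throughput $R$ is *achievable* if there are such a schedule and, for every node, a route (a simple path with hops between distinct nodes at most $r$ rings apart) to its destination, such that on every hop of every route the schedule carries data of the corresponding flow at a long-run average rate of at least $R$. *Claim.* The achievable per-node throughput is $$R(n)=\begin{cases}\Theta\left(W/\sqrt n\right), & r=\Theta(1)\ \text{and}\ \alpha>2\quad\text{(short-hop scheme)},\\ \Theta\left(W/n\right), & r=\Theta(\sqrt n)\ \text{and}\ \alpha\ge 2\quad\text{(long-hop scheme)},\end{cases}$$ in the following sense, with $g(n)=1/\sqrt n$ and $g(n)=1/n$ respectively: there are constants $c,C>0$, which depend neither on $n$ nor on $W$ nor on the law of the positions, such that as $L\to\infty$ the probability that the throughput $c\,W g(n)$ is achievable tends to $1$ and the probability that the throughput $C\,W g(n)$ is achievable tends to $0$. -/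

import Mathlib

open Filter MeasureTheory ProbabilityTheory Asymptotics
open scoped Topology ENNReal

universe u

noncomputable section

namespace HexMesh

/-! ### Hexagonal cells -/

/-- Number of hops between the origin cell and the cell with axial coordinates `p` in the hexagonal
tiling, in which the six neighbours of the origin are `±(1,0)`, `±(0,1)` and `±(1,-1)`. -/
def hexNorm (p : ℤ × ℤ) : ℕ :=
  max (max p.1.natAbs p.2.natAbs) (p.1 + p.2).natAbs

/-- The cells of the network: a central cell together with `L` outer rings around it. -/
def cells (L : ℕ) : Finset (ℤ × ℤ) :=
  (Finset.Icc (-(L : ℤ)) L ×ˢ Finset.Icc (-(L : ℤ)) L).filter fun p => hexNorm p ≤ L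

/-- The cells of the network with `L` rings. Each cell contains exactly one node, so this type also
indexes the nodes, and (a node being the source of exactly one flow) the data flows. -/
abbrev Cell (L : ℕ) : Type := {p : ℤ × ℤ // p ∈ cells L}

/-- The number `n` of nodes of the network with `L` rings. -/
def numNodes (L : ℕ) : ℕ := Fintype.card (Cell L)

/-- Number of hops between two cells: `j` lies in the `l`-th outer ring of `i` if and only if
`hopDist i j = l`. -/
def hopDist {L : ℕ} (i j : Cell L) : ℕ := hexNorm (i.1 - j.1)

/-- The centre of a hexagonal cell of side length `a`; the centres of neighbouring cells are at
distance `√3 a`. -/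
def center (a : ℝ) (p : ℤ × ℤ) : EuclideanSpace ℝ (Fin 2) :=
  !₂[√3 * a * ((p.1 : ℝ) + (p.2 : ℝ) / 2), 3 / 2 * a * (p.2 : ℝ)]

/-- Positions of the nodes. -/
abbrev Placement (L : ℕ) : Type := Cell L → EuclideanSpace ℝ (Fin 2)

/-! ### Physical layer -/

/-- Constants of the wireless channel: path loss exponent, effective antenna gain, threshold on the
received power, noise power. -/
structure Channel where
  pathLoss : ℝ
  gain : ℝ
  threshold : ℝ
  noise : ℝ

/-- The largest distance between two nodes that are at most `r` rings apart. -/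
def maxRange {L : ℕ} (r : ℕ) (X : Placement L) : ℝ :=
  sSup {ρ : ℝ | ∃ i j : Cell L, hopDist i j ≤ r ∧ ρ = dist (X i) (X j)}

/-- The common transmit power of all nodes: the least power `P` with
`gain * P * maxRange ^ (-pathLoss) = threshold`. -/
def txPower {L : ℕ} (ch : Channel) (r : ℕ) (X : Placement L) : ℝ :=
  ch.threshold * maxRange r X ^ ch.pathLoss / ch.gain

/-- Power received by node `j` from node `i`. -/
def rxPower {L : ℕ} (ch : Channel) (r : ℕ) (X : Placement L) (i j : Cell L) : ℝ :=
  ch.gain * txPower ch r X * dist (X i) (X j) ^ (-ch.pathLoss)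

/-- Signal-to-interference-plus-noise ratio at `j` of the signal sent by `i`, when the set of
transmitting nodes is `A`. -/
def sinr {L : ℕ} (ch : Channel) (r : ℕ) (X : Placement L) (A : Finset (Cell L)) (i j : Cell L) : ℝ :=
  rxPower ch r X i j / (ch.noise + ∑ k ∈ A.erase i, rxPower ch r X k j)

/-- Transmission rate from `i` to `j` over the bandwidth `W`, by Shannon's formula. -/
def linkRate {L : ℕ} (ch : Channel) (W : ℝ) (r : ℕ) (X : Placement L) (A : Finset (Cell L))
    (i j : Cell L) : ℝ :=
  W * Real.logb 2 (1 + sinr ch r X A i j)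

/-! ### Scheduling, routing and throughput -/

/-- A periodic time-division schedule with slots of equal length. `tx t i = some (j, f)` means that
in slot `t` node `i` transmits to node `j` data of the flow whose source is `f`, and `tx t i = none`
that node `i` is silent in slot `t`. -/
structure Schedule (L : ℕ) where
  period : ℕ
  period_pos : 0 < period
  tx : Fin period → Cell L → Option (Cell L × Cell L)

/-- The set of nodes that transmit in slot `t`. -/
def Schedule.active {L : ℕ} (S : Schedule L) (t : Fin S.period) : Finset (Cell L) :=
  Finset.univ.filter fun i => (S.tx t i).isSome

/-- The schedule is admissible for the transmission range `r` (in rings): transmissions go to other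
nodes inside the `r`-th outer ring, and while a node receives, all nodes inside the `r`-th outer ring
around it (itself included), except the one transmitting to it, are silent. -/
def Schedule.Admissible {L : ℕ} (S : Schedule L) (r : ℕ) : Prop :=
  ∀ (t : Fin S.period) (i j f : Cell L), S.tx t i = some (j, f) →
    i ≠ j ∧ hopDist i j ≤ r ∧ ∀ k ∈ S.active t, k ≠ i → r < hopDist k j

/-- Long-run average rate at which the schedule carries data of the flow with source `f` from `i`
to `j`. -/
def Schedule.carried {L : ℕ} (S : Schedule L) (ch : Channel) (W : ℝ) (r : ℕ) (X : Placement L)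
    (i j f : Cell L) : ℝ :=
  (∑ t : Fin S.period,
    if S.tx t i = some (j, f) then linkRate ch W r X (S.active t) i j else 0) / (S.period : ℝ)

/-- The graph of possible links: two distinct nodes are linked if each lies inside the `r`-th outer
ring of the other. -/
def linkGraph (L r : ℕ) : SimpleGraph (Cell L) :=
  SimpleGraph.fromRel fun i j => hopDist i j ≤ r

/-- With destinations `d`, node positions `X`, bandwidth `W` and transmission range `r` (in rings),
the per-node throughput `R` is achievable: there are an admissible schedule and, for every node `f`,
a route from `f` to its destination, such that every hop of every route carries data of the
corresponding flow at rate at least `R`. -/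
def Achievable {L : ℕ} (ch : Channel) (W : ℝ) (r : ℕ) (X : Placement L) (d : Cell L → Cell L)
    (R : ℝ) : Prop :=
  ∃ S : Schedule L, S.Admissible r ∧
    ∃ route : (f : Cell L) → (linkGraph L r).Path f (d f),
      ∀ f : Cell L, ∀ e ∈ (route f).1.darts, R ≤ S.carried ch W r X e.fst e.snd f

/-! ### Random traffic and the order of the throughput -/

/-- Every node chooses its destination uniformly at random among the other nodes, independently of
the choices of the other nodes. -/
def IsUniformTraffic {L : ℕ} {Ω : Type u} [MeasurableSpace Ω] (μ : Measure Ω)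
    (D : Cell L → Ω → Cell L) : Prop :=
  (∀ i, Measurable (D i)) ∧ iIndepFun D μ ∧
    ∀ i j, i ≠ j → μ {ω | D i ω = j} = ((numNodes L - 1 : ℕ) : ℝ≥0∞)⁻¹

/-- In hexagonal networks of side length `a` with `L → ∞` rings, perturbation range `δ` (with `δ = 0`
for the regular network) and transmission range `r L`, the achievable per-node throughput is, with
high probability, of exact order `W * g n`. The constants depend neither on the bandwidth, nor on the
probability spaces, nor on the law of the positions, which is arbitrary within the perturbation
range. -/
def ThroughputHasOrder (a δ : ℝ) (ch : Channel) (r : ℕ → ℕ) (g : ℝ → ℝ) : Prop :=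
  ∃ c C : ℝ, 0 < c ∧ 0 < C ∧
    ∀ (W : ℝ), 0 < W →
    ∀ (Ω : ℕ → Type u) [∀ L, MeasurableSpace (Ω L)] (μ : (L : ℕ) → Measure (Ω L))
      [∀ L, IsProbabilityMeasure (μ L)]
      (D : (L : ℕ) → Cell L → Ω L → Cell L)
      (X : (L : ℕ) → Ω L → Placement L),
      (∀ L, IsUniformTraffic (μ L) (D L)) →
      (∀ L, ∀ᵐ ω ∂(μ L), ∀ i, dist (X L ω i) (center a i.1) ≤ δ) →
      Tendsto (fun L => μ L {ω | ¬ Achievable ch W (r L) (X L ω) (fun i => D L i ω)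
        (c * (W * g (numNodes L)))}) atTop (𝓝 0) ∧
      Tendsto (fun L => μ L {ω | Achievable ch W (r L) (X L ω) (fun i => D L i ω)
        (C * (W * g (numNodes L)))}) atTop (𝓝 0)

end HexMesh

end

namespace HexMesh

/-! ### Geometry of the hexagonal tiling -/

/-! The placement enters only through `HopBounds`: distances between nodes are proportional to hop
counts, up to constants fixed by `a` and `δ`. Everything about positions is then deterministic, so
their law is irrelevant; randomness remains only in the destinations.

Upper bounds come from counting transported bit-hops. If every flow gets rate R, the schedule must
make average progress at least R times the sum of all source-destination hop distances
(`mul_sum_hopDist_le_of_achievable`), and that sum is of order nL with high probability. One link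
makes progress O(Wr) (`hopDist_mul_linkRate_le`). With r bounded, n links give O(nW) per slot, hence
R = O(W/L). With r of order L, split the links at length r/2 (`progress_le_of_long_range`). The
short ones have well separated transmitters, so there are O(1) of them. A long one receives a
bounded signal, while every other transmitter interferes with at least constant power, so its rate
is O(W/|A|). A slot then makes progress O(WL), hence R = O(W/n).

For achievability, routes follow lattice lines and turn at most once (`exists_path`), so a cell
relays only flows whose source or destination lies on its three lines. A Chernoff bound makes this
O(L) flows for all cells at once. Short hops reuse slots along residue classes modulo 2r+1;
interference is bounded by a lattice sum that converges for exponent above 2, and O(L) slots per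
class suffice. Long hops send one packet at a time: routes have O(1) hops, so O(n) slots suffice. -/

theorem hexNorm_neg (p : ℤ × ℤ) : hexNorm (-p) = hexNorm p := by
  simp only [hexNorm, Prod.fst_neg, Prod.snd_neg, ← neg_add, Int.natAbs_neg]

theorem hexNorm_le_iff {p : ℤ × ℤ} {m : ℕ} :
    hexNorm p ≤ m ↔ (-(m : ℤ) ≤ p.1 ∧ p.1 ≤ m) ∧ (-(m : ℤ) ≤ p.2 ∧ p.2 ≤ m) ∧
      -(m : ℤ) ≤ p.1 + p.2 ∧ p.1 + p.2 ≤ m := by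
  rw [hexNorm, max_le_iff, max_le_iff]; omega

theorem hexNorm_eq (p : ℤ × ℤ) : hexNorm p = p.1.natAbs ∨ hexNorm p = p.2.natAbs ∨
    hexNorm p = (p.1 + p.2).natAbs := by
  rw [hexNorm]; omega

theorem hexNorm_add_le (p q : ℤ × ℤ) : hexNorm (p + q) ≤ hexNorm p + hexNorm q := by
  obtain ⟨⟨_, _⟩, ⟨_, _⟩, _, _⟩ := hexNorm_le_iff.1 (le_refl (hexNorm p))
  obtain ⟨⟨_, _⟩, ⟨_, _⟩, _, _⟩ := hexNorm_le_iff.1 (le_refl (hexNorm q))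
  rw [hexNorm_le_iff]
  simp only [Prod.fst_add, Prod.snd_add]; push_cast
  refine ⟨⟨?_, ?_⟩, ⟨?_, ?_⟩, ?_, ?_⟩ <;> linarith

theorem hexNorm_eq_zero {p : ℤ × ℤ} : hexNorm p = 0 ↔ p = 0 := by
  obtain ⟨x, y⟩ := p
  simp only [hexNorm, Prod.mk_eq_zero]; omega

theorem mem_cells {L : ℕ} {p : ℤ × ℤ} : p ∈ cells L ↔ hexNorm p ≤ L := by
  unfold cells
  rw [Finset.mem_filter, Finset.mem_product, Finset.mem_Icc, Finset.mem_Icc, hexNorm_le_iff]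
  tauto

section Cells

variable {L : ℕ}

theorem hopDist_comm (i j : Cell L) : hopDist i j = hopDist j i := by
  rw [hopDist, hopDist, ← hexNorm_neg, neg_sub]

theorem hopDist_triangle (i j k : Cell L) : hopDist i k ≤ hopDist i j + hopDist j k := by
  have := hexNorm_add_le (i.1 - j.1) (j.1 - k.1)
  rwa [sub_add_sub_cancel] at this

@[simp] theorem hopDist_self (i : Cell L) : hopDist i i = 0 := by
  simp [hopDist, hexNorm]

theorem hopDist_eq_zero {i j : Cell L} : hopDist i j = 0 ↔ i = j := by
  rw [hopDist, hexNorm_eq_zero, sub_eq_zero, Subtype.ext_iff]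

theorem one_le_hopDist {i j : Cell L} (h : i ≠ j) : 1 ≤ hopDist i j :=
  Nat.one_le_iff_ne_zero.2 (mt hopDist_eq_zero.1 h)

theorem hopDist_le (i j : Cell L) : hopDist i j ≤ 2 * L := by
  have h := hexNorm_add_le i.1 (-j.1)
  rw [hexNorm_neg, ← sub_eq_add_neg] at h
  have hi := mem_cells.1 i.2
  have hj := mem_cells.1 j.2
  unfold hopDist; omega

theorem numNodes_eq (L : ℕ) : numNodes L = (cells L).card := by
  simp [numNodes]

theorem sq_le_numNodes (L : ℕ) : (L + 1) ^ 2 ≤ numNodes L := by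
  have hsub : Finset.Icc (0 : ℤ) L ×ˢ Finset.Icc (-(L : ℤ)) 0 ⊆ cells L := by
    intro p hp
    simp only [Finset.mem_product, Finset.mem_Icc] at hp
    rw [mem_cells, hexNorm_le_iff]
    refine ⟨⟨?_, ?_⟩, ⟨?_, ?_⟩, ?_, ?_⟩ <;> linarith
  have := Finset.card_le_card hsub
  rw [Finset.card_product, Int.card_Icc, Int.card_Icc, ← numNodes_eq] at this
  calc (L + 1) ^ 2 = ((L : ℤ) + 1 - 0).toNat * (0 + 1 - (-(L : ℤ))).toNat := by
        rw [show ((L : ℤ) + 1 - 0).toNat = L + 1 by omega,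
          show (0 + 1 - (-(L : ℤ))).toNat = L + 1 by omega, sq]
    _ ≤ _ := this

theorem card_filter_box (i : Cell L) (m : ℕ) :
    (Finset.univ.filter fun j : Cell L => hopDist i j ≤ m).card ≤ (2 * m + 1) ^ 2 := by
  classical
  have : (Finset.univ.filter fun j : Cell L => hopDist i j ≤ m).card
      ≤ (Finset.Icc (-(m : ℤ)) m ×ˢ Finset.Icc (-(m : ℤ)) m).card := by
    refine Finset.card_le_card_of_injOn (fun j => i.1 - j.1) ?_ ?_
    · intro j hj
      have hj := hexNorm_le_iff.1 (Finset.mem_filter.1 hj).2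
      exact Finset.mem_product.2 ⟨Finset.mem_Icc.2 hj.1, Finset.mem_Icc.2 hj.2.1⟩
    · intro j _ k _ h
      exact Subtype.ext (sub_right_injective h)
  refine this.trans (le_of_eq ?_)
  rw [Finset.card_product, Int.card_Icc, show ((m : ℤ) + 1 - (-(m : ℤ))).toNat = 2 * m + 1 by omega,
    sq]

theorem numNodes_le_sq (L : ℕ) : numNodes L ≤ (2 * L + 1) ^ 2 := by
  have h : hexNorm 0 ≤ L := by simp [hexNorm]
  refine le_trans (le_of_eq ?_) (card_filter_box (⟨0, mem_cells.2 h⟩ : Cell L) L)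
  rw [numNodes, ← Finset.card_univ, Finset.filter_true_of_mem]
  intro j _
  have := mem_cells.1 j.2
  simpa [hopDist, hexNorm_neg] using this

/-- The quadratic form is the squared distance between cell centres divided by 3a². It is at most
(x+y)² when xy ≥ 0, and at most max(x², y²) otherwise. -/
theorem hexNorm_sq_le (p : ℤ × ℤ) :
    (p.1 : ℝ) ^ 2 + p.1 * p.2 + (p.2 : ℝ) ^ 2 ≤ (hexNorm p : ℝ) ^ 2 := by
  have h1 : |(p.1 : ℝ)| ≤ hexNorm p := by
    rw [← Int.cast_abs, Int.abs_eq_natAbs]; norm_cast; simp only [hexNorm]; omega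
  have h2 : |(p.2 : ℝ)| ≤ hexNorm p := by
    rw [← Int.cast_abs, Int.abs_eq_natAbs]; norm_cast; simp only [hexNorm]; omega
  have h3 : |(p.1 : ℝ) + p.2| ≤ hexNorm p := by
    rw [← Int.cast_add, ← Int.cast_abs, Int.abs_eq_natAbs]; norm_cast; simp only [hexNorm]; omega
  generalize (p.1 : ℝ) = u at *
  generalize (p.2 : ℝ) = v at *
  generalize (hexNorm p : ℝ) = h at *
  have h1' := sq_le_sq' (abs_le.1 h1).1 (abs_le.1 h1).2
  have h2' := sq_le_sq' (abs_le.1 h2).1 (abs_le.1 h2).2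
  have h3' := sq_le_sq' (abs_le.1 h3).1 (abs_le.1 h3).2
  rcases le_total 0 (u * v) with huv | huv
  · nlinarith
  · rcases le_total (|u|) (|v|) with h | h
    · have : u ^ 2 + u * v ≤ 0 := by
        have := mul_nonneg (abs_nonneg u) (sub_nonneg.2 h)
        have e : u * v = -(|u| * |v|) := by rw [← abs_mul, abs_of_nonpos huv, neg_neg]
        nlinarith [sq_abs u]
      linarith
    · have : v ^ 2 + u * v ≤ 0 := by
        have := mul_nonneg (abs_nonneg v) (sub_nonneg.2 h)
        have e : u * v = -(|u| * |v|) := by rw [← abs_mul, abs_of_nonpos huv, neg_neg]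
        nlinarith [sq_abs v]
      linarith

/-- For each of the three coordinates, the form minus 3/4 of its square is a perfect square, up to a
positive factor. -/
theorem le_hexNorm_sq (p : ℤ × ℤ) :
    3 / 4 * (hexNorm p : ℝ) ^ 2 ≤ (p.1 : ℝ) ^ 2 + p.1 * p.2 + (p.2 : ℝ) ^ 2 := by
  have key : (hexNorm p : ℝ) ^ 2 = (p.1 : ℝ) ^ 2 ∨ (hexNorm p : ℝ) ^ 2 = (p.2 : ℝ) ^ 2 ∨
      (hexNorm p : ℝ) ^ 2 = ((p.1 : ℝ) + p.2) ^ 2 := by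
    rcases hexNorm_eq p with h | h | h <;> rw [h, Nat.cast_natAbs, Int.cast_abs, sq_abs] <;> simp
  rcases key with h | h | h <;> rw [h]
  · nlinarith [sq_nonneg ((p.1 : ℝ) / 2 + p.2)]
  · nlinarith [sq_nonneg ((p.1 : ℝ) + p.2 / 2)]
  · nlinarith [sq_nonneg ((p.1 : ℝ) - p.2)]

theorem dist_center (a : ℝ) (ha : 0 ≤ a) (p q : ℤ × ℤ) :
    dist (center a p) (center a q) = √3 * a *
      √(((p - q).1 : ℝ) ^ 2 + (p - q).1 * (p - q).2 + ((p - q).2 : ℝ) ^ 2) := by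
  have h3 : √(3 : ℝ) ^ 2 = 3 := Real.sq_sqrt (by norm_num)
  rw [EuclideanSpace.dist_eq, Fin.sum_univ_two, Real.dist_eq, Real.dist_eq, sq_abs, sq_abs,
    ← Real.sqrt_sq (show 0 ≤ √3 * a by positivity), ← Real.sqrt_mul (sq_nonneg _)]
  congr 1
  simp only [center, Prod.fst_sub, Prod.snd_sub, Int.cast_sub]
  simp
  linear_combination (a ^ 2 * (((p.1 : ℝ) + p.2 / 2 - (q.1 + q.2 / 2)) ^ 2 -
    ((p.1 - q.1 : ℝ) ^ 2 + (p.1 - q.1) * (p.2 - q.2) + (p.2 - q.2 : ℝ) ^ 2))) * h3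

/-- Distances between nodes are comparable to the numbers of hops between their cells. -/
def HopBounds (κ β : ℝ) (X : Placement L) : Prop :=
  ∀ i j, κ * hopDist i j ≤ dist (X i) (X j) ∧ dist (X i) (X j) ≤ β * hopDist i j

/-- Perturbation changes a distance by at most 2δ. Neighbouring centres are √3a apart, so δ < √3a/2
keeps all distances positive. The factor 1/2 in κ pays for the distance per hop being only 3a/2 in
the worst direction, and 2δ < √3a is absorbed by doubling √3a. -/
theorem hopBounds_of_dist_center_le {a δ : ℝ} (ha : 0 < a) (hδ₀ : 0 ≤ δ) (hδ : δ < √3 / 2 * a)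
    {X : Placement L} (hX : ∀ i, dist (X i) (center a i.1) ≤ δ) :
    HopBounds ((√3 * a - 2 * δ) / 2) (2 * √3 * a) X := by
  intro i j
  rcases eq_or_ne i j with rfl | hij
  · simp
  have hh : (1 : ℝ) ≤ hopDist i j := by exact_mod_cast one_le_hopDist hij
  have hint : (hopDist i j : ℝ) = 1 ∨ (2 : ℝ) ≤ hopDist i j := by
    have := one_le_hopDist hij
    rcases this.eq_or_lt with h | h
    · left; rw [← h]; simp
    · right; exact_mod_cast h
  have hs : √(3 : ℝ) ≤ 2 := by rw [Real.sqrt_le_left] <;> norm_num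
  have hlo := le_hexNorm_sq (i.1 - j.1)
  have hhi := hexNorm_sq_le (i.1 - j.1)
  have hd := dist_center a ha.le i.1 j.1
  have h3 : √(3 : ℝ) ^ 2 = 3 := Real.sq_sqrt (by norm_num)
  have h30 : 0 ≤ √(3 : ℝ) := Real.sqrt_nonneg 3
  change 3 / 4 * (hopDist i j : ℝ) ^ 2 ≤ _ at hlo
  change _ ≤ (hopDist i j : ℝ) ^ 2 at hhi
  -- The form is integer-valued, so positivity gives at least 1.
  have hq1 : (1 : ℝ) ≤ ((i.1 - j.1).1 : ℝ) ^ 2 + (i.1 - j.1).1 * (i.1 - j.1).2 +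
      ((i.1 - j.1).2 : ℝ) ^ 2 := by
    have : (0 : ℝ) < ((i.1 - j.1).1 : ℝ) ^ 2 + (i.1 - j.1).1 * (i.1 - j.1).2 +
      ((i.1 - j.1).2 : ℝ) ^ 2 := by nlinarith
    norm_cast at this ⊢
  set q := ((i.1 - j.1).1 : ℝ) ^ 2 + (i.1 - j.1).1 * (i.1 - j.1).2 + ((i.1 - j.1).2 : ℝ) ^ 2
  generalize (hopDist i j : ℝ) = h at *
  have hs1 : √q ≤ h := by
    rw [Real.sqrt_le_left (by linarith)]; exact hhi
  have hs2 : 1 ≤ √q := Real.one_le_sqrt.2 hq1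
  have hs3 : √3 / 2 * h ≤ √q := by
    apply Real.le_sqrt_of_sq_le; nlinarith
  have hD1 : dist (X i) (X j) ≤ dist (center a i.1) (center a j.1) + 2 * δ := by
    have := dist_triangle4 (X i) (center a i.1) (center a j.1) (X j)
    have h1 := hX i
    have h2 := hX j
    rw [dist_comm] at h2
    linarith
  have hD2 : dist (center a i.1) (center a j.1) ≤ dist (X i) (X j) + 2 * δ := by
    have := dist_triangle4 (center a i.1) (X i) (X j) (center a j.1)
    have h1 := hX i
    have h2 := hX j
    rw [dist_comm] at h1
    linarith
  rw [hd] at hD1 hD2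
  have hpos : 0 < √3 * a := by positivity
  constructor
  · have e1 : √3 * a ≤ √3 * a * √q := le_mul_of_one_le_right hpos.le hs2
    have e2 : 3 / 2 * a * h ≤ √3 * a * √q := by
      calc 3 / 2 * a * h = √3 * a * (√3 / 2 * h) := by linear_combination (-a * h / 2) * h3
        _ ≤ _ := by gcongr
    rcases hint with rfl | h2
    · nlinarith
    · have h4 : 0 ≤ δ * (h - 2) := mul_nonneg hδ₀ (by linarith)
      have h5 := mul_nonneg (mul_nonneg ha.le (by linarith : 0 ≤ h)) (sub_nonneg.2 hs)
      nlinarith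
  · have e1 : √3 * a * √q ≤ √3 * a * h := by gcongr
    nlinarith

end Cells

/-! ### Received power and transmission rates -/

section Radio

variable {L r : ℕ} {X : Placement L} {κ β : ℝ} {ch : Channel} {i j : Cell L}

theorem dist_le_maxRange (X : Placement L) (h : hopDist i j ≤ r) :
    dist (X i) (X j) ≤ maxRange r X := by
  refine le_csSup ?_ ⟨i, j, h, rfl⟩
  refine ((Set.finite_range fun x : Cell L × Cell L => dist (X x.1) (X x.2)).subset ?_).bddAbove
  rintro _ ⟨i, j, -, rfl⟩
  exact ⟨(i, j), rfl⟩

/-- Since r ≤ L, the central cell and the cell (r, 0) form a pair exactly r hops apart. -/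
theorem HopBounds.mul_le_maxRange (hX : HopBounds κ β X) (hr : r ≤ L) :
    κ * r ≤ maxRange r X := by
  have h0 : ((0 : ℤ), (0 : ℤ)) ∈ cells L := by rw [mem_cells]; simp [hexNorm]
  have h1 : ((r : ℤ), (0 : ℤ)) ∈ cells L := by rw [mem_cells]; simpa [hexNorm] using hr
  have h : hopDist (⟨_, h1⟩ : Cell L) ⟨_, h0⟩ = r := by simp [hopDist, hexNorm]
  have := (hX ⟨_, h1⟩ ⟨_, h0⟩).1
  rw [h] at this
  exact this.trans (dist_le_maxRange X h.le)

theorem HopBounds.maxRange_le (hX : HopBounds κ β X) (hβ : 0 ≤ β) : maxRange r X ≤ β * r := by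
  refine Real.sSup_le ?_ (by positivity)
  rintro _ ⟨i, j, h, rfl⟩
  refine (hX i j).2.trans ?_
  gcongr

theorem maxRange_nonneg (X : Placement L) : 0 ≤ maxRange r X := by
  refine Real.sSup_nonneg ?_
  rintro _ ⟨i, j, -, rfl⟩
  exact dist_nonneg

/-- The gain cancels: received power depends only on the ratio of the distance to the maximal range,
so it is invariant under scaling. -/
theorem rxPower_eq (hgain : 0 < ch.gain) (X : Placement L) (i j : Cell L) :
    rxPower ch r X i j = ch.threshold * (maxRange r X / dist (X i) (X j)) ^ ch.pathLoss := by
  rw [rxPower, txPower, Real.div_rpow (maxRange_nonneg X) dist_nonneg, Real.rpow_neg dist_nonneg]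
  field_simp

theorem rxPower_nonneg (hgain : 0 < ch.gain) (hT : 0 < ch.threshold) (X : Placement L)
    (i j : Cell L) : 0 ≤ rxPower ch r X i j := by
  rw [rxPower_eq hgain]
  have := maxRange_nonneg (r := r) X
  positivity

theorem sinr_nonneg (hgain : 0 < ch.gain) (hT : 0 < ch.threshold) (hη : 0 < ch.noise)
    (X : Placement L) (A : Finset (Cell L)) (i j : Cell L) : 0 ≤ sinr ch r X A i j :=
  div_nonneg (rxPower_nonneg hgain hT X i j)
    (add_nonneg hη.le (Finset.sum_nonneg fun k _ => rxPower_nonneg hgain hT X k j))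

theorem HopBounds.dist_pos (hX : HopBounds κ β X) (hκ : 0 < κ) (hij : i ≠ j) :
    0 < dist (X i) (X j) := by
  have h : (0 : ℝ) < hopDist i j := by exact_mod_cast one_le_hopDist hij
  exact (mul_pos hκ h).trans_le (hX i j).1

theorem HopBounds.threshold_le_rxPower (hX : HopBounds κ β X) (hκ : 0 < κ) (hgain : 0 < ch.gain)
    (hT : 0 < ch.threshold) (hα : 0 ≤ ch.pathLoss) (hij : i ≠ j) (h : hopDist i j ≤ r) :
    ch.threshold ≤ rxPower ch r X i j := by
  rw [rxPower_eq hgain]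
  refine le_mul_of_one_le_right hT.le (Real.one_le_rpow ?_ hα)
  rw [one_le_div (hX.dist_pos hκ hij)]
  exact dist_le_maxRange X h

theorem HopBounds.rxPower_le (hX : HopBounds κ β X) (hκ : 0 < κ) (hβ : 0 ≤ β)
    (hgain : 0 < ch.gain) (hT : 0 < ch.threshold) (hα : 0 ≤ ch.pathLoss) (hij : i ≠ j) :
    rxPower ch r X i j ≤ ch.threshold * (β * r / (κ * hopDist i j)) ^ ch.pathLoss := by
  rw [rxPower_eq hgain]
  have h : (0 : ℝ) < hopDist i j := by exact_mod_cast one_le_hopDist hij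
  have hm := maxRange_nonneg (r := r) X
  gcongr
  · exact hX.maxRange_le hβ
  · exact (hX i j).1

theorem HopBounds.le_rxPower (hX : HopBounds κ β X) (hκ : 0 < κ)
    (hgain : 0 < ch.gain) (hT : 0 < ch.threshold) (hα : 0 ≤ ch.pathLoss) (hr : r ≤ L)
    (hij : i ≠ j) :
    ch.threshold * (κ * r / (β * hopDist i j)) ^ ch.pathLoss ≤ rxPower ch r X i j := by
  rw [rxPower_eq hgain]
  have hd := hX.dist_pos hκ hij
  gcongr
  · exact div_nonneg (by positivity) (hd.le.trans (hX i j).2)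
  · exact maxRange_nonneg X
  · exact hX.mul_le_maxRange hr
  · exact (hX i j).2

theorem linkRate_nonneg {W : ℝ} (hgain : 0 < ch.gain) (hT : 0 < ch.threshold) (hη : 0 < ch.noise)
    (hW : 0 ≤ W) (X : Placement L) (A : Finset (Cell L)) (i j : Cell L) :
    0 ≤ linkRate ch W r X A i j :=
  mul_nonneg hW (Real.logb_nonneg one_lt_two
    (le_add_of_nonneg_right (sinr_nonneg hgain hT hη X A i j)))

theorem linkRate_mono {W s : ℝ} (hW : 0 ≤ W) {A : Finset (Cell L)} (hs : 0 ≤ s)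
    (h : s ≤ sinr ch r X A i j) : W * Real.logb 2 (1 + s) ≤ linkRate ch W r X A i j := by
  unfold linkRate
  gcongr
  norm_num

theorem linkRate_le {W s : ℝ} (hW : 0 ≤ W) {A : Finset (Cell L)}
    (h0 : 0 ≤ sinr ch r X A i j) (h : sinr ch r X A i j ≤ s) :
    linkRate ch W r X A i j ≤ W * Real.logb 2 (1 + s) := by
  unfold linkRate
  gcongr
  norm_num

/-- If the total interference is at most `I`, a link is served at rate at least
`W * log₂ (1 + threshold / (noise + I))`. -/
theorem HopBounds.le_linkRate {W I : ℝ} (hX : HopBounds κ β X) (hκ : 0 < κ) (hgain : 0 < ch.gain)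
    (hT : 0 < ch.threshold) (hη : 0 < ch.noise) (hα : 0 ≤ ch.pathLoss) (hW : 0 ≤ W)
    {A : Finset (Cell L)} (hij : i ≠ j) (h : hopDist i j ≤ r)
    (hI : ∑ k ∈ A.erase i, rxPower ch r X k j ≤ I) :
    W * Real.logb 2 (1 + ch.threshold / (ch.noise + I)) ≤ linkRate ch W r X A i j := by
  have h0 : 0 ≤ ∑ k ∈ A.erase i, rxPower ch r X k j :=
    Finset.sum_nonneg fun k _ => rxPower_nonneg hgain hT X k j
  refine linkRate_mono hW (div_nonneg hT.le (by linarith)) ?_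
  unfold sinr
  gcongr
  · exact rxPower_nonneg hgain hT X i j
  · exact hX.threshold_le_rxPower hκ hgain hT hα hij h

/-- The progress of a link, i.e. its length in hops times its rate, is at most of the order of
the transmission range. -/
theorem HopBounds.hopDist_mul_linkRate_le {W : ℝ} (hX : HopBounds κ β X) (hκ : 0 < κ) (hβ : 0 ≤ β)
    (hgain : 0 < ch.gain) (hT : 0 < ch.threshold) (hη : 0 < ch.noise) (hα : 0 ≤ ch.pathLoss)
    (hW : 0 ≤ W) (A : Finset (Cell L)) (hij : i ≠ j) (h : hopDist i j ≤ r) :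
    hopDist i j * linkRate ch W r X A i j ≤
      (Real.log (1 + ch.threshold * (β / κ) ^ ch.pathLoss / ch.noise) + ch.pathLoss) / Real.log 2
        * (W * r) := by
  set v := ch.threshold * (β / κ) ^ ch.pathLoss / ch.noise with hv
  have hv0 : 0 ≤ v := by positivity
  have hh : (1 : ℝ) ≤ hopDist i j := by exact_mod_cast one_le_hopDist hij
  have hhr : (hopDist i j : ℝ) ≤ r := by exact_mod_cast h
  set x : ℝ := r / hopDist i j with hx
  have hx1 : 1 ≤ x := by rw [hx, one_le_div (by linarith)]; exact hhr
  have hlog2 : 0 < Real.log 2 := Real.log_pos one_lt_two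
  have hs : sinr ch r X A i j ≤ v * x ^ ch.pathLoss := by
    have hI : 0 ≤ ∑ k ∈ A.erase i, rxPower ch r X k j :=
      Finset.sum_nonneg fun k _ => rxPower_nonneg hgain hT X k j
    calc sinr ch r X A i j ≤ rxPower ch r X i j / ch.noise := by
          unfold sinr
          gcongr
          · exact rxPower_nonneg hgain hT X i j
          · linarith
      _ ≤ ch.threshold * (β * r / (κ * hopDist i j)) ^ ch.pathLoss / ch.noise := by
          gcongr
          exact hX.rxPower_le hκ hβ hgain hT hα hij
      _ = v * x ^ ch.pathLoss := by
          rw [mul_div_mul_comm, Real.mul_rpow (by positivity) (by positivity), hv]; ring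
  have hxα : 1 ≤ x ^ ch.pathLoss := Real.one_le_rpow hx1 hα
  -- With x = r/h, the rate grows only like log x ≤ x, so rate times h is O(r).
  have hlog : Real.log (1 + v * x ^ ch.pathLoss) ≤ (Real.log (1 + v) + ch.pathLoss) * x := by
    calc Real.log (1 + v * x ^ ch.pathLoss) ≤ Real.log ((1 + v) * x ^ ch.pathLoss) := by
          apply Real.log_le_log (by positivity)
          nlinarith
      _ = Real.log (1 + v) + ch.pathLoss * Real.log x := by
          rw [Real.log_mul (by positivity) (by positivity), Real.log_rpow (by linarith)]
      _ ≤ Real.log (1 + v) * x + ch.pathLoss * x := by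
          have := Real.log_nonneg (by linarith : 1 ≤ 1 + v)
          gcongr
          · exact le_mul_of_one_le_right this hx1
          · exact Real.log_le_self (by linarith)
      _ = _ := by ring
  calc hopDist i j * linkRate ch W r X A i j
      ≤ hopDist i j * (W * Real.logb 2 (1 + v * x ^ ch.pathLoss)) := by
        gcongr
        exact linkRate_le hW (sinr_nonneg hgain hT hη X A i j) hs
    _ ≤ hopDist i j * (W * ((Real.log (1 + v) + ch.pathLoss) * x / Real.log 2)) := by
        unfold Real.logb
        gcongr
    _ = _ := by rw [hx]; field_simp

end Radio

/-! ### Concentration of the random traffic -/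

/-- A Chernoff bound: if `N` counts independent events with expected number at most `q`, then
`N ≥ 2 * q` has probability at most `(3 / 4) ^ q`. -/
theorem measure_two_mul_le_card_le {ι β Ω : Type*} [Fintype ι] [MeasurableSpace β]
    [MeasurableSpace Ω] {μ : Measure Ω} [IsProbabilityMeasure μ] {D : ι → Ω → β}
    (hD : ∀ i, Measurable (D i)) (hind : iIndepFun D μ) {B : ι → Set β}
    [∀ i, DecidablePred (· ∈ B i)] (hB : ∀ i, MeasurableSet (B i)) {p : ℝ} (hp : 0 ≤ p)
    (hμ : ∀ i, μ {ω | D i ω ∈ B i} ≤ ENNReal.ofReal p) {q : ℕ} (hq : Fintype.card ι * p ≤ q) :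
    μ {ω | 2 * q ≤ (Finset.univ.filter fun i => D i ω ∈ B i).card} ≤
      ENNReal.ofReal ((3 / 4) ^ q) := by
  -- The product of the `g i` is 2^N. By independence its mean is at most (1+p)^n ≤ e^q, and Markov
  -- at level 4^q leaves (e/4)^q.
  set g : ι → β → ℝ≥0∞ := fun i => 1 + (B i).indicator 1 with hg
  have hgm : ∀ i, Measurable (g i) := fun i =>
    measurable_const.add (measurable_one.indicator (hB i))
  have hprod : ∀ ω, ∏ i, g i (D i ω) =
      2 ^ (Finset.univ.filter fun i => D i ω ∈ B i).card := by
    intro ω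
    rw [← Finset.prod_const, Finset.prod_filter]
    refine Finset.prod_congr rfl fun i _ => ?_
    by_cases h : D i ω ∈ B i <;> simp [hg, h, one_add_one_eq_two]
  have hint : ∫⁻ ω, ∏ i, g i (D i ω) ∂μ ≤ ENNReal.ofReal (Real.exp q) := by
    have h1 := lintegral_prod_eq_prod_lintegral_of_indepFun Finset.univ
      (fun i ω => g i (D i ω)) (hind.comp g hgm) (fun i => (hgm i).comp (hD i))
    rw [h1]
    have h2 : ∀ i, ∫⁻ ω, g i (D i ω) ∂μ ≤ ENNReal.ofReal (Real.exp p) := by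
      intro i
      have h3 : ∫⁻ ω, g i (D i ω) ∂μ = 1 + μ {ω | D i ω ∈ B i} := by
        have : ∀ ω, g i (D i ω) = 1 + (D i ⁻¹' B i).indicator 1 ω := fun ω => rfl
        simp_rw [this]
        rw [lintegral_add_left measurable_const, lintegral_indicator_one ((hD i) (hB i))]
        simp; rfl
      rw [h3]
      calc 1 + μ {ω | D i ω ∈ B i} ≤ ENNReal.ofReal 1 + ENNReal.ofReal p := by
            rw [ENNReal.ofReal_one]; gcongr; exact hμ i
        _ = ENNReal.ofReal (p + 1) := by rw [← ENNReal.ofReal_add zero_le_one hp, add_comm]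
        _ ≤ _ := ENNReal.ofReal_le_ofReal (Real.add_one_le_exp p)
    calc ∏ i, ∫⁻ ω, g i (D i ω) ∂μ ≤ ∏ _i : ι, ENNReal.ofReal (Real.exp p) :=
          Finset.prod_le_prod' fun i _ => h2 i
      _ = ENNReal.ofReal (Real.exp (Fintype.card ι * p)) := by
          rw [Finset.prod_const, Finset.card_univ, ← ENNReal.ofReal_pow (Real.exp_pos _).le,
            Real.exp_nat_mul]
      _ ≤ _ := ENNReal.ofReal_le_ofReal (Real.exp_le_exp.2 hq)
  have hmeas : Measurable fun ω => ∏ i, g i (D i ω) :=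
    Finset.measurable_prod _ fun i _ => (hgm i).comp (hD i)
  have hmarkov := mul_meas_ge_le_lintegral (μ := μ) hmeas (2 ^ (2 * q))
  have hsub : {ω | 2 * q ≤ (Finset.univ.filter fun i => D i ω ∈ B i).card} ⊆
      {ω | 2 ^ (2 * q) ≤ ∏ i, g i (D i ω)} := by
    intro ω hω
    rw [Set.mem_ofPred_eq] at hω ⊢
    rw [hprod]
    exact pow_le_pow_right₀ one_le_two hω
  have h4 : (2 : ℝ≥0∞) ^ (2 * q) = ENNReal.ofReal (4 ^ q) := by
    rw [pow_mul, ENNReal.ofReal_pow (by norm_num)]; norm_num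
  refine (measure_mono hsub).trans ?_
  rw [h4] at hmarkov ⊢
  have h5 : ENNReal.ofReal (4 ^ q) ≠ 0 := by positivity
  calc μ {ω | ENNReal.ofReal (4 ^ q) ≤ ∏ i, g i (D i ω)}
      ≤ ENNReal.ofReal (Real.exp q) / ENNReal.ofReal (4 ^ q) := by
        rw [ENNReal.le_div_iff_mul_le (Or.inl h5) (Or.inl ENNReal.ofReal_ne_top), mul_comm]
        exact hmarkov.trans hint
    _ = ENNReal.ofReal ((Real.exp 1 / 4) ^ q) := by
        rw [← ENNReal.ofReal_div_of_pos (by positivity), div_pow, ← Real.exp_nat_mul, mul_one]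
    _ ≤ _ := by
        apply ENNReal.ofReal_le_ofReal
        have := Real.exp_one_lt_three
        gcongr

section Traffic

variable {L : ℕ} {Ω : Type*} [MeasurableSpace Ω] {μ : Measure Ω} [IsProbabilityMeasure μ]
  {D : Cell L → Ω → Cell L}

/-- The n-1 other destinations already carry total probability 1; `1 ≤ L` ensures that there are
any. -/
theorem IsUniformTraffic.measure_eq_self (hD : IsUniformTraffic μ D) (hL : 1 ≤ L) (i : Cell L) :
    μ {ω | D i ω = i} = 0 := by
  classical
  have hn : 2 ≤ numNodes L := by have := sq_le_numNodes L; nlinarith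
  have htot : ∑ j, μ {ω | D i ω = j} = 1 := by
    have h := sum_measure_preimage_singleton (μ := μ) (f := D i) Finset.univ
      (fun j _ => (hD.1 i) (measurableSet_singleton j))
    simp only [Finset.coe_univ, Set.preimage_univ, measure_univ] at h
    exact h
  rw [← Finset.add_sum_erase _ _ (Finset.mem_univ i),
    Finset.sum_congr rfl (fun j hj => hD.2.2 i j (Finset.ne_of_mem_erase hj).symm),
    Finset.sum_const, Finset.card_erase_of_mem (Finset.mem_univ i), Finset.card_univ,
    nsmul_eq_mul] at htot
  change _ + ((numNodes L - 1 : ℕ) : ℝ≥0∞) * _ = 1 at htot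
  rw [ENNReal.mul_inv_cancel (Nat.cast_ne_zero.2 (by omega)) (by simp)] at htot
  exact (ENNReal.add_right_inj ENNReal.one_ne_top).1 (by rw [add_comm, htot, add_zero])

theorem IsUniformTraffic.measure_mem_le (hD : IsUniformTraffic μ D) (hL : 1 ≤ L) (i : Cell L)
    {B : Finset (Cell L)} {p : ℝ} (hB : (B.card : ℝ) ≤ p * (numNodes L - 1)) :
    μ {ω | D i ω ∈ B} ≤ ENNReal.ofReal p := by
  have hn : 2 ≤ numNodes L := by have := sq_le_numNodes L; nlinarith
  have hn' : (0 : ℝ) < ((numNodes L - 1 : ℕ) : ℝ) := by exact_mod_cast (by omega)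
  have h1 : {ω | D i ω ∈ B} = ⋃ j ∈ B, {ω | D i ω = j} := by ext; simp
  rw [h1]
  calc μ (⋃ j ∈ B, {ω | D i ω = j}) ≤ ∑ j ∈ B, μ {ω | D i ω = j} := measure_biUnion_finset_le _ _
    _ ≤ ∑ _j ∈ B, ((numNodes L - 1 : ℕ) : ℝ≥0∞)⁻¹ := by
        refine Finset.sum_le_sum fun j _ => ?_
        rcases eq_or_ne i j with rfl | h
        · rw [hD.measure_eq_self hL]; exact zero_le
        · rw [hD.2.2 i j h]
    _ = ENNReal.ofReal (B.card / ((numNodes L - 1 : ℕ) : ℝ)) := by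
        rw [Finset.sum_const, nsmul_eq_mul, ENNReal.ofReal_div_of_pos hn', ENNReal.ofReal_natCast,
          ENNReal.ofReal_natCast, div_eq_mul_inv]
    _ ≤ _ := by
        apply ENNReal.ofReal_le_ofReal
        rw [div_le_iff₀ hn', Nat.cast_sub (by omega), Nat.cast_one]
        exact hB

/-- Most flows go far: except with exponentially small probability, the sum of the distances between
the sources and their destinations is of order `n * L`. -/
theorem IsUniformTraffic.measure_sum_hopDist_lt_le (hD : IsUniformTraffic μ D) (hL : 8 ≤ L) :
    μ {ω | 32 * (∑ f, (hopDist f (D f ω) : ℝ)) < numNodes L * L} ≤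
      ENNReal.ofReal ((3 / 4) ^ (numNodes L / 4)) := by
  classical
  have hn := sq_le_numNodes L
  have hq : ((numNodes L : ℕ) : ℝ) * (1 / 16) ≤ ((numNodes L / 4 : ℕ) : ℝ) := by
    have h4 : numNodes L ≤ 16 * (numNodes L / 4) := by
      have : 4 ≤ numNodes L := by nlinarith
      omega
    have : (numNodes L : ℝ) ≤ 16 * ((numNodes L / 4 : ℕ) : ℝ) := by exact_mod_cast h4
    linarith
  -- A ball of radius L/16 holds at most 1/16 of the cells. With q = ⌊n/4⌋, fewer than n/2 flows end
  -- in their ball, so the other half contributes at least (n/2)(L/16).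
  set B : Cell L → Finset (Cell L) := fun f => Finset.univ.filter fun j => hopDist f j ≤ L / 16
  have hcard : ∀ f, ((B f).card : ℝ) ≤ 1 / 16 * (numNodes L - 1) := by
    intro f
    have h1 := card_filter_box f (L / 16)
    have h2 : 4 * (2 * (L / 16) + 1) ≤ L := by omega
    have h3 : 16 * (B f).card + 1 ≤ numNodes L := by
      change (B f).card ≤ _ at h1
      have h3 := Nat.pow_le_pow_left h2 2
      rw [mul_pow] at h3
      nlinarith
    have : (16 * (B f).card + 1 : ℝ) ≤ numNodes L := by exact_mod_cast h3
    linarith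
  have key := measure_two_mul_le_card_le (μ := μ) hD.1 hD.2.1 (B := fun f => (B f : Set (Cell L)))
    (fun f => (B f).measurableSet) (p := 1 / 16) (by norm_num)
    (fun f => hD.measure_mem_le (by omega) f (hcard f)) (q := numNodes L / 4) hq
  refine (measure_mono ?_).trans key
  intro ω hω
  change 32 * (∑ f, (hopDist f (D f ω) : ℝ)) < numNodes L * L at hω
  rw [Set.mem_ofPred_eq]
  by_contra! hlt
  set N := Finset.univ.filter fun f => D f ω ∈ (B f : Set (Cell L)) with hN
  have hc : N.card + Nᶜ.card = numNodes L := by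
    rw [Finset.card_add_card_compl]; rfl
  have hfar : ∀ f ∈ Nᶜ, (L : ℝ) / 16 ≤ hopDist f (D f ω) := by
    intro f hf
    have : L / 16 < hopDist f (D f ω) := by
      simpa [hN, B] using hf
    have h2 : L ≤ 16 * hopDist f (D f ω) := by omega
    have : (L : ℝ) ≤ 16 * hopDist f (D f ω) := by exact_mod_cast h2
    linarith
  have hs1 : (Nᶜ.card : ℝ) * (L / 16) ≤ ∑ f, (hopDist f (D f ω) : ℝ) := by
    calc (Nᶜ.card : ℝ) * (L / 16) = ∑ f ∈ Nᶜ, (L / 16 : ℝ) := by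
          rw [Finset.sum_const, nsmul_eq_mul]
      _ ≤ ∑ f ∈ Nᶜ, (hopDist f (D f ω) : ℝ) := Finset.sum_le_sum hfar
      _ ≤ _ := Finset.sum_le_sum_of_subset_of_nonneg (Finset.subset_univ _)
          fun _ _ _ => Nat.cast_nonneg _
  have hhalf : (numNodes L : ℝ) ≤ 2 * Nᶜ.card := by
    have : numNodes L ≤ 2 * Nᶜ.card := by omega
    exact_mod_cast this
  have hL0 : (0 : ℝ) ≤ L := Nat.cast_nonneg L
  nlinarith

/-- The cells that share one of their three coordinates with `v`. -/
noncomputable def lines (v : Cell L) : Finset (Cell L) :=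
  Finset.univ.filter fun p => p.1.1 = v.1.1 ∨ p.1.2 = v.1.2 ∨ p.1.1 + p.1.2 = v.1.1 + v.1.2

theorem mem_lines {v p : Cell L} : p ∈ lines v ↔
    p.1.1 = v.1.1 ∨ p.1.2 = v.1.2 ∨ p.1.1 + p.1.2 = v.1.1 + v.1.2 := by
  simp [lines]

theorem mem_lines_comm {v p : Cell L} : p ∈ lines v ↔ v ∈ lines p := by
  rw [mem_lines, mem_lines]; tauto

theorem card_lines_le (v : Cell L) : (lines v).card ≤ 3 * (2 * L + 1) := by
  classical
  have hI : (Finset.Icc (-(L : ℤ)) L).card = 2 * L + 1 := by rw [Int.card_Icc]; omega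
  have h1 : (Finset.univ.filter fun p : Cell L => p.1.1 = v.1.1).card ≤ 2 * L + 1 := by
    rw [← hI]
    refine Finset.card_le_card_of_injOn (fun p => p.1.2) ?_ ?_
    · intro p _
      exact Finset.mem_Icc.2 (hexNorm_le_iff.1 (mem_cells.1 p.2)).2.1
    · intro p hp q hq h
      have hp := (Finset.mem_filter.1 hp).2
      have hq := (Finset.mem_filter.1 hq).2
      exact Subtype.ext (Prod.ext (hp.trans hq.symm) h)
  have h2 : (Finset.univ.filter fun p : Cell L => p.1.2 = v.1.2).card ≤ 2 * L + 1 := by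
    rw [← hI]
    refine Finset.card_le_card_of_injOn (fun p => p.1.1) ?_ ?_
    · intro p _
      exact Finset.mem_Icc.2 (hexNorm_le_iff.1 (mem_cells.1 p.2)).1
    · intro p hp q hq h
      have hp := (Finset.mem_filter.1 hp).2
      have hq := (Finset.mem_filter.1 hq).2
      exact Subtype.ext (Prod.ext h (hp.trans hq.symm))
  have h3 : (Finset.univ.filter fun p : Cell L => p.1.1 + p.1.2 = v.1.1 + v.1.2).card ≤
      2 * L + 1 := by
    rw [← hI]
    refine Finset.card_le_card_of_injOn (fun p => p.1.1) ?_ ?_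
    · intro p _
      exact Finset.mem_Icc.2 (hexNorm_le_iff.1 (mem_cells.1 p.2)).1
    · intro p hp q hq h
      have hp := (Finset.mem_filter.1 hp).2
      have hq := (Finset.mem_filter.1 hq).2
      have h : p.1.1 = q.1.1 := h
      exact Subtype.ext (Prod.ext h (by linarith))
  have hsub := Finset.card_union_le (Finset.univ.filter fun p : Cell L => p.1.1 = v.1.1)
    ((Finset.univ.filter fun p : Cell L => p.1.2 = v.1.2) ∪
      Finset.univ.filter fun p : Cell L => p.1.1 + p.1.2 = v.1.1 + v.1.2)
  have hsub' := Finset.card_union_le (Finset.univ.filter fun p : Cell L => p.1.2 = v.1.2)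
      (Finset.univ.filter fun p : Cell L => p.1.1 + p.1.2 = v.1.1 + v.1.2)
  rw [← Finset.filter_or, ← Finset.filter_or] at hsub
  rw [← Finset.filter_or] at hsub'
  unfold lines
  omega

/-- Except with exponentially small probability, on the three lines through any cell there are
only `O(L)` destinations. -/
theorem IsUniformTraffic.measure_exists_card_lines_le (hD : IsUniformTraffic μ D) (hL : 1 ≤ L) :
    μ {ω | ∃ v, 36 * L ≤ (Finset.univ.filter fun f => D f ω ∈ lines v).card} ≤
      ENNReal.ofReal (9 * (L : ℝ) ^ 2 * (3 / 4) ^ L) := by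
  classical
  have hn : (2 : ℝ) ≤ numNodes L := by
    have : 2 ≤ numNodes L := by have := sq_le_numNodes L; nlinarith
    exact_mod_cast this
  have hL' : (1 : ℝ) ≤ L := by exact_mod_cast hL
  have hset : {ω | ∃ v, 36 * L ≤ (Finset.univ.filter fun f => D f ω ∈ lines v).card} =
      ⋃ v ∈ (Finset.univ : Finset (Cell L)),
        {ω | 36 * L ≤ (Finset.univ.filter fun f => D f ω ∈ lines v).card} := by
    ext; simp
  rw [hset]
  have hv : ∀ v : Cell L, μ {ω | 36 * L ≤ (Finset.univ.filter fun f => D f ω ∈ lines v).card} ≤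
      ENNReal.ofReal ((3 / 4) ^ L) := by
    intro v
    have hc : ((lines v).card : ℝ) ≤ 9 * L := by
      have := card_lines_le v
      have : (lines v).card ≤ 9 * L := by omega
      exact_mod_cast this
    have hp : 0 ≤ 9 * (L : ℝ) / (numNodes L - 1) := div_nonneg (by positivity) (by linarith)
    -- The mean is at most n·9L/(n-1) ≤ 18L, whence `q = 18 * L`. The tail is small enough for a
    -- union bound over all n = O(L²) cells.
    have key := measure_two_mul_le_card_le (μ := μ) hD.1 hD.2.1
      (B := fun _ => (lines v : Set (Cell L))) (fun f => (lines v).measurableSet) hp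
      (fun f => hD.measure_mem_le hL f (by
        rw [div_mul_cancel₀ _ (by linarith)]; exact hc)) (q := 18 * L) (by
        change (numNodes L : ℝ) * _ ≤ _
        rw [← mul_div_assoc, div_le_iff₀ (by linarith)]
        push_cast
        nlinarith)
    have h36 : 36 * L = 2 * (18 * L) := by ring
    rw [h36]
    refine key.trans (ENNReal.ofReal_le_ofReal ?_)
    exact pow_le_pow_of_le_one (by norm_num) (by norm_num) (by omega)
  calc _ ≤ ∑ v : Cell L, μ {ω | 36 * L ≤ (Finset.univ.filter fun f => D f ω ∈ lines v).card} :=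
        measure_biUnion_finset_le _ _
    _ ≤ ∑ _v : Cell L, ENNReal.ofReal ((3 / 4) ^ L) := Finset.sum_le_sum fun v _ => hv v
    _ = ENNReal.ofReal (numNodes L * (3 / 4) ^ L) := by
        rw [Finset.sum_const, Finset.card_univ, nsmul_eq_mul,
          ENNReal.ofReal_mul (Nat.cast_nonneg _), ENNReal.ofReal_natCast]
        rfl
    _ ≤ _ := by
        apply ENNReal.ofReal_le_ofReal
        gcongr
        have : numNodes L ≤ 9 * L ^ 2 := by have := numNodes_le_sq L; nlinarith
        exact_mod_cast this

end Traffic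

/-! ### Upper bounds on the throughput -/

/-- A path visits each vertex once, so a hop is determined by its starting point. This lets slots be
indexed by flow and transmitter alone. -/
theorem eq_of_mem_darts_of_fst_eq {V : Type*} {G : SimpleGraph V} {u v : V} {p : G.Walk u v}
    (hp : p.IsPath) {e e' : G.Dart} (he : e ∈ p.darts) (he' : e' ∈ p.darts)
    (h : e.fst = e'.fst) : e = e' := by
  have hnd : (p.darts.map (·.fst)).Nodup := by
    rw [SimpleGraph.Walk.map_fst_darts]
    exact hp.support_nodup.sublist (List.dropLast_sublist _)
  exact List.inj_on_of_nodup_map hnd he he' h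

theorem nodup_darts_of_isPath {V : Type*} {G : SimpleGraph V} {u v : V} {p : G.Walk u v}
    (hp : p.IsPath) : p.darts.Nodup := by
  have hnd : (p.darts.map (·.fst)).Nodup := by
    rw [SimpleGraph.Walk.map_fst_darts]
    exact hp.support_nodup.sublist (List.dropLast_sublist _)
  exact hnd.of_map

section Converse

variable {L r : ℕ} {X : Placement L} {κ β W : ℝ} {ch : Channel}

theorem hopDist_le_sum_darts {f g : Cell L} (p : (linkGraph L r).Walk f g) :
    hopDist f g ≤ (p.darts.map fun e => hopDist e.fst e.snd).sum := by
  induction p with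
  | nil => simp
  | cons h p ih =>
    simp only [SimpleGraph.Walk.darts_cons, List.map_cons, List.sum_cons]
    exact (hopDist_triangle _ _ _).trans (Nat.add_le_add_left ih _)

/-- The progress made in slot `t`: the sum, over all active links, of the rate times the number of
hops. -/
noncomputable def Schedule.progress (S : Schedule L) (ch : Channel) (W : ℝ) (r : ℕ) (X : Placement L)
    (t : Fin S.period) : ℝ :=
  ∑ i, ∑ x : Cell L × Cell L, if S.tx t i = some x then
    hopDist i x.1 * linkRate ch W r X (S.active t) i x.1 else 0

/-- By the triangle inequality the hops of a route add up to at least the distance to its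
destination, and each carries rate R; summed over flows, this is at most the time-averaged progress.
-/
theorem mul_sum_hopDist_le_of_achievable {d : Cell L → Cell L} {R B : ℝ} (hR : 0 ≤ R)
    (hgain : 0 < ch.gain) (hT : 0 < ch.threshold) (hη : 0 < ch.noise) (hW : 0 ≤ W)
    (hB : ∀ S : Schedule L, S.Admissible r → ∀ t, S.progress ch W r X t ≤ B)
    (h : Achievable ch W r X d R) : R * ∑ f, (hopDist f (d f) : ℝ) ≤ B := by
  classical
  obtain ⟨S, hS, route, hroute⟩ := h
  have hcar : ∀ i j f, 0 ≤ S.carried ch W r X i j f := by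
    intro i j f
    refine div_nonneg (Finset.sum_nonneg fun t _ => ?_) (Nat.cast_nonneg _)
    split_ifs
    · exact linkRate_nonneg hgain hT hη hW X _ _ _
    · exact le_rfl
  have hf : ∀ f, R * (hopDist f (d f) : ℝ) ≤
      ∑ x : Cell L × Cell L, hopDist x.1 x.2 * S.carried ch W r X x.1 x.2 f := by
    intro f
    have hp := (route f).2
    set p := (route f).1
    have h1 : (hopDist f (d f) : ℝ) ≤ ∑ e ∈ p.darts.toFinset, (hopDist e.fst e.snd : ℝ) := by
      rw [List.sum_toFinset _ (nodup_darts_of_isPath hp)]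
      have := hopDist_le_sum_darts p
      have h2 : (hopDist f (d f) : ℝ) ≤ ((p.darts.map fun e => hopDist e.fst e.snd).sum : ℕ) := by
        exact_mod_cast this
      rwa [Nat.cast_list_sum, List.map_map] at h2
    calc R * (hopDist f (d f) : ℝ) ≤ R * ∑ e ∈ p.darts.toFinset, (hopDist e.fst e.snd : ℝ) := by
          gcongr
      _ = ∑ e ∈ p.darts.toFinset, hopDist e.fst e.snd * R := by
          rw [mul_comm, Finset.sum_mul]
      _ ≤ ∑ e ∈ p.darts.toFinset, hopDist e.fst e.snd * S.carried ch W r X e.fst e.snd f := by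
          refine Finset.sum_le_sum fun e he => ?_
          gcongr
          exact hroute f e (List.mem_toFinset.1 he)
      _ = ∑ x ∈ p.darts.toFinset.image (fun e => e.toProd),
            hopDist x.1 x.2 * S.carried ch W r X x.1 x.2 f := by
          rw [Finset.sum_image]
          intro e _ e' _ h
          exact SimpleGraph.Dart.ext _ _ h
      _ ≤ _ := Finset.sum_le_sum_of_subset_of_nonneg (Finset.subset_univ _)
          fun x _ _ => mul_nonneg (Nat.cast_nonneg _) (hcar _ _ _)
  have hper : (0 : ℝ) < S.period := by exact_mod_cast S.period_pos
  have hswap : ∑ f, ∑ x : Cell L × Cell L, hopDist x.1 x.2 * S.carried ch W r X x.1 x.2 f =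
      (∑ t, S.progress ch W r X t) / S.period := by
    unfold Schedule.progress Schedule.carried
    rw [eq_div_iff hper.ne']
    simp_rw [Fintype.sum_prod_type, mul_div_assoc', Finset.mul_sum, mul_ite, mul_zero]
    rw [Finset.sum_mul]
    simp_rw [Finset.sum_mul, div_mul_cancel₀ _ hper.ne']
    rw [Finset.sum_comm]
    simp_rw [Finset.sum_comm (s := (Finset.univ : Finset (Fin S.period)))]
    rw [Finset.sum_congr rfl]
    intro i _
    rw [Finset.sum_comm]
  calc R * ∑ f, (hopDist f (d f) : ℝ)
      ≤ ∑ f, ∑ x : Cell L × Cell L, hopDist x.1 x.2 * S.carried ch W r X x.1 x.2 f := by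
        rw [Finset.mul_sum]
        exact Finset.sum_le_sum fun f _ => hf f
    _ = (∑ t, S.progress ch W r X t) / S.period := hswap
    _ ≤ B := by
        rw [div_le_iff₀ hper]
        calc ∑ t, S.progress ch W r X t ≤ ∑ _t : Fin S.period, B :=
              Finset.sum_le_sum fun t _ => hB S hS t
          _ = _ := by simp [mul_comm]

/-- A node has at most one receiver and one flow per slot, so its inner sum has at most one nonzero
term. -/
theorem Schedule.progress_le_sum {S : Schedule L} {t : Fin S.period} {G : Cell L → ℝ}
    (hG : ∀ i x, S.tx t i = some x →
      hopDist i x.1 * linkRate ch W r X (S.active t) i x.1 ≤ G i) :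
    S.progress ch W r X t ≤ ∑ i ∈ S.active t, G i := by
  classical
  unfold Schedule.progress
  conv_rhs => rw [Schedule.active, Finset.sum_filter]
  refine Finset.sum_le_sum fun i _ => ?_
  cases h : S.tx t i with
  | none => simp
  | some x =>
    simp only [Option.some.injEq, Option.isSome_some, if_true]
    rw [Finset.sum_ite_eq]
    simpa using hG i x h

/-- Bound on the progress in a slot that only uses the bound on the progress of a single link. -/
theorem HopBounds.progress_le_of_all (hX : HopBounds κ β X) (hκ : 0 < κ) (hβ : 0 ≤ β)
    (hgain : 0 < ch.gain) (hT : 0 < ch.threshold) (hη : 0 < ch.noise) (hα : 0 ≤ ch.pathLoss)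
    (hW : 0 ≤ W) {S : Schedule L} (hS : S.Admissible r) (t : Fin S.period) :
    S.progress ch W r X t ≤ numNodes L *
      ((Real.log (1 + ch.threshold * (β / κ) ^ ch.pathLoss / ch.noise) + ch.pathLoss) / Real.log 2
        * (W * r)) := by
  set E := (Real.log (1 + ch.threshold * (β / κ) ^ ch.pathLoss / ch.noise) + ch.pathLoss) /
    Real.log 2 * (W * r)
  have hE : 0 ≤ E := by
    have : 0 ≤ Real.log (1 + ch.threshold * (β / κ) ^ ch.pathLoss / ch.noise) :=
      Real.log_nonneg (le_add_of_nonneg_right (by positivity))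
    have := Real.log_pos one_lt_two
    positivity
  refine (Schedule.progress_le_sum (G := fun _ => E) ?_).trans ?_
  · rintro i ⟨j, f⟩ h
    obtain ⟨hij, hr, -⟩ := hS t i j f h
    exact hX.hopDist_mul_linkRate_le hκ hβ hgain hT hη hα hW _ hij hr
  · rw [Finset.sum_const, nsmul_eq_mul]
    gcongr
    exact_mod_cast Finset.card_le_univ _

/-- A set of cells that are pairwise more than `m` hops apart has at most
`(2 * L / (m / 2 + 1) + 2) ^ 2` elements. -/
theorem card_le_of_separated {A : Finset (Cell L)} {m : ℕ}
    (hA : ∀ i ∈ A, ∀ j ∈ A, i ≠ j → m < hopDist i j) :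
    A.card ≤ (2 * (L / (m / 2 + 1)) + 2) ^ 2 := by
  -- Cut the plane into s × s blocks. Within a block each coordinate differs by at most s-1, hence
  -- their sum by at most 2(s-1) ≤ m, so a block holds at most one element of `A`.
  set s : ℤ := ((m / 2 + 1 : ℕ) : ℤ) with hs
  have hs0 : 0 < s := by positivity
  set q : ℤ := ((L / (m / 2 + 1) : ℕ) : ℤ) with hq
  have hLq : (L : ℤ) < (q + 1) * s := by
    have := Nat.lt_div_mul_add (a := L) (b := m / 2 + 1) (by omega)
    zify at this
    rw [hq, hs]; push_cast; linarith
  have hbox : ∀ x : ℤ, -(L : ℤ) ≤ x → x ≤ L → x / s ∈ Finset.Icc (-(q + 1)) q := by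
    intro x h1 h2
    rw [Finset.mem_Icc]
    constructor
    · rw [Int.le_ediv_iff_mul_le hs0]; linarith
    · have : x / s < q + 1 := by rw [Int.ediv_lt_iff_lt_mul hs0]; linarith
      omega
  have hcard : A.card ≤ (Finset.Icc (-(q + 1)) q ×ˢ Finset.Icc (-(q + 1)) q).card := by
    refine Finset.card_le_card_of_injOn (fun i => (i.1.1 / s, i.1.2 / s)) ?_ ?_
    · intro i _
      obtain ⟨h1, h2, -⟩ := hexNorm_le_iff.1 (mem_cells.1 i.2)
      exact Finset.mem_product.2 ⟨hbox _ h1.1 h1.2, hbox _ h2.1 h2.2⟩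
    · intro i hi j hj h
      by_contra hij
      have hfar := hA i hi j hj hij
      refine hfar.not_ge (hexNorm_le_iff.2 ?_)
      obtain ⟨h1, h2⟩ := Prod.mk.inj h
      have a1 := Int.emod_add_mul_ediv i.1.1 s
      have a2 := Int.emod_add_mul_ediv j.1.1 s
      have a3 := Int.emod_add_mul_ediv i.1.2 s
      have a4 := Int.emod_add_mul_ediv j.1.2 s
      rw [h1] at a1
      rw [h2] at a3
      have b1 := Int.emod_nonneg i.1.1 hs0.ne'
      have b2 := Int.emod_nonneg j.1.1 hs0.ne'
      have b3 := Int.emod_nonneg i.1.2 hs0.ne'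
      have b4 := Int.emod_nonneg j.1.2 hs0.ne'
      have c1 := Int.emod_lt_of_pos i.1.1 hs0
      have c2 := Int.emod_lt_of_pos j.1.1 hs0
      have c3 := Int.emod_lt_of_pos i.1.2 hs0
      have c4 := Int.emod_lt_of_pos j.1.2 hs0
      have hsm : 2 * (s - 1) ≤ m := by rw [hs]; omega
      simp only [Prod.fst_sub, Prod.snd_sub]
      refine ⟨⟨?_, ?_⟩, ⟨?_, ?_⟩, ?_, ?_⟩ <;> linarith
  refine hcard.trans (le_of_eq ?_)
  rw [Finset.card_product, Int.card_Icc, ← sq]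
  congr 1
  omega

/-- Long links see the interference of all other transmitters, so that their rate is inversely
proportional to the number of transmitters. -/
theorem HopBounds.hopDist_mul_linkRate_le_div_card (hX : HopBounds κ β X) (hκ : 0 < κ)
    (hβ : 0 < β) (hgain : 0 < ch.gain) (hT : 0 < ch.threshold) (hη : 0 < ch.noise)
    (hα : 0 ≤ ch.pathLoss) (hW : 0 ≤ W) {K : ℝ} (hK : 0 < K) (hr1 : 1 ≤ r) (hr : r ≤ L)
    (hLK : L ≤ K * r)
    {A : Finset (Cell L)} {i j : Cell L} (hi : i ∈ A) (hij : i ≠ j) (h : hopDist i j ≤ r)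
    (hlong : r < 2 * hopDist i j) (hA : ∀ k ∈ A, k ≠ i → r < hopDist k j) :
    hopDist i j * linkRate ch W r X A i j ≤
      ch.threshold * (2 * β / κ) ^ ch.pathLoss /
        min ch.noise (ch.threshold * (κ / (2 * β * K)) ^ ch.pathLoss) / Real.log 2 * (W * r)
          / A.card := by
  set c := min ch.noise (ch.threshold * (κ / (2 * β * K)) ^ ch.pathLoss) with hc
  have hc0 : 0 < c := lt_min hη (by positivity)
  have hr0 : (0 : ℝ) < r := by exact_mod_cast hr1
  have hh : (1 : ℝ) ≤ hopDist i j := by exact_mod_cast one_le_hopDist hij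
  have hhr : (hopDist i j : ℝ) ≤ r := by exact_mod_cast h
  have hlong' : (r : ℝ) ≤ 2 * hopDist i j := by exact_mod_cast hlong.le
  have hlog2 : 0 < Real.log 2 := Real.log_pos one_lt_two
  have hm : (1 : ℝ) ≤ A.card := by exact_mod_cast Finset.card_pos.2 ⟨i, hi⟩
  set v := ch.threshold * (2 * β / κ) ^ ch.pathLoss with hv
  have hv0 : 0 < v := by positivity
  have hsig : rxPower ch r X i j ≤ v := by
    refine (hX.rxPower_le hκ hβ.le hgain hT hα hij).trans ?_
    refine mul_le_mul_of_nonneg_left (Real.rpow_le_rpow (by positivity) ?_ hα) hT.le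
    rw [div_le_div_iff₀ (by positivity) hκ]
    nlinarith [mul_pos hβ hκ]
  -- Every interferer is within 2L ≤ 2Kr hops, so its power is at least a constant. The noise stands
  -- in for the erased term `i`, which is why `c` is a minimum and the full `A.card` appears.
  have hint : c * A.card ≤ ch.noise + ∑ k ∈ A.erase i, rxPower ch r X k j := by
    have h1 : ∀ k ∈ A.erase i, c ≤ rxPower ch r X k j := by
      intro k hk
      have hkj := hA k (Finset.mem_of_mem_erase hk) (Finset.ne_of_mem_erase hk)
      have hne : k ≠ j := by rintro rfl; simp at hkj
      refine (min_le_right _ _).trans (le_trans ?_ (hX.le_rxPower hκ hgain hT hα hr hne))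
      have h2 : (hopDist k j : ℝ) ≤ 2 * (K * r) := by
        have : (hopDist k j : ℝ) ≤ 2 * L := by exact_mod_cast hopDist_le k j
        linarith
      have h3 : (0 : ℝ) < hopDist k j := by exact_mod_cast (Nat.zero_le r).trans_lt hkj
      refine mul_le_mul_of_nonneg_left (Real.rpow_le_rpow (by positivity) ?_ hα) hT.le
      rw [div_le_div_iff₀ (by positivity) (by positivity)]
      calc κ * (β * hopDist k j) ≤ κ * (β * (2 * (K * r))) := by gcongr
        _ = _ := by ring
    have h2 : ((A.erase i).card : ℝ) * c ≤ ∑ k ∈ A.erase i, rxPower ch r X k j := by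
      rw [← nsmul_eq_mul]; exact Finset.card_nsmul_le_sum _ _ _ h1
    rw [Finset.card_erase_of_mem hi, Nat.cast_sub (Finset.card_pos.2 ⟨i, hi⟩), Nat.cast_one] at h2
    have := min_le_left ch.noise (ch.threshold * (κ / (2 * β * K)) ^ ch.pathLoss)
    rw [← hc] at this
    nlinarith
  have hs : sinr ch r X A i j ≤ v / (c * A.card) := by
    unfold sinr
    gcongr
  have hlog : Real.log (1 + v / (c * A.card)) ≤ v / (c * A.card) := by
    have := Real.log_le_sub_one_of_pos (show 0 < 1 + v / (c * A.card) by positivity)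
    linarith
  calc hopDist i j * linkRate ch W r X A i j
      ≤ r * (W * (v / (c * A.card) / Real.log 2)) := by
        have h5 : linkRate ch W r X A i j ≤ W * (v / (c * A.card) / Real.log 2) := by
          refine (linkRate_le hW (sinr_nonneg hgain hT hη X A i j) hs).trans ?_
          unfold Real.logb
          gcongr
        exact mul_le_mul hhr h5 (linkRate_nonneg hgain hT hη hW X _ _ _) hr0.le
    _ = _ := by field_simp

/-- Links of length at most r/2 are O(K²) in number, each with progress O(Wr). The remaining at most
|A| links make progress O(Wr/|A|) each. -/
theorem HopBounds.progress_le_of_long_range (hX : HopBounds κ β X) (hκ : 0 < κ)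
    (hβ : 0 < β) (hgain : 0 < ch.gain) (hT : 0 < ch.threshold) (hη : 0 < ch.noise)
    (hα : 0 ≤ ch.pathLoss) (hW : 0 ≤ W) {K : ℝ} (hK : 0 < K) (hr1 : 1 ≤ r) (hr : r ≤ L)
    (hLK : L ≤ K * r) {S : Schedule L} (hS : S.Admissible r) (t : Fin S.period) :
    S.progress ch W r X t ≤
      ((8 * K + 2) ^ 2 * ((Real.log (1 + ch.threshold * (β / κ) ^ ch.pathLoss / ch.noise) +
          ch.pathLoss) / Real.log 2) +
        ch.threshold * (2 * β / κ) ^ ch.pathLoss /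
          min ch.noise (ch.threshold * (κ / (2 * β * K)) ^ ch.pathLoss) / Real.log 2)
        * (W * r) := by
  classical
  set E := (Real.log (1 + ch.threshold * (β / κ) ^ ch.pathLoss / ch.noise) + ch.pathLoss) /
    Real.log 2 with hE
  set F := ch.threshold * (2 * β / κ) ^ ch.pathLoss /
          min ch.noise (ch.threshold * (κ / (2 * β * K)) ^ ch.pathLoss) / Real.log 2 with hF
  have hlog2 := Real.log_pos one_lt_two
  have hE0 : 0 ≤ E := by
    have : 0 ≤ Real.log (1 + ch.threshold * (β / κ) ^ ch.pathLoss / ch.noise) :=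
      Real.log_nonneg (le_add_of_nonneg_right (by positivity))
    positivity
  have hF0 : 0 ≤ F := by positivity
  set A := S.active t with hA
  set short : Cell L → Prop := fun i => ∃ x, S.tx t i = some x ∧ 2 * hopDist i x.1 ≤ r with hshort
  refine (Schedule.progress_le_sum
    (G := fun i => if short i then E * (W * r) else F * (W * r) / A.card) ?_).trans ?_
  · rintro i ⟨j, f⟩ h
    obtain ⟨hij, hhop, hk⟩ := hS t i j f h
    split_ifs with hsh
    · exact hX.hopDist_mul_linkRate_le hκ hβ.le hgain hT hη hα hW _ hij hhop
    · refine hX.hopDist_mul_linkRate_le_div_card hκ hβ hgain hT hη hα hW hK hr1 hr hLK ?_ hij hhop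
        ?_ hk
      · simp [Schedule.active, h]
      · by_contra hcon
        exact hsh ⟨(j, f), h, not_lt.1 hcon⟩
  · rw [Finset.sum_ite, Finset.sum_const, Finset.sum_const, nsmul_eq_mul, nsmul_eq_mul]
    -- The receiver of `i` is within r/2 of `i` but more than r from `k`.
    have hsep : ∀ i ∈ A.filter short, ∀ k ∈ A.filter short, i ≠ k → r / 2 < hopDist i k := by
      intro i hi k hk hik
      obtain ⟨⟨j, f⟩, hx, hlen⟩ := (Finset.mem_filter.1 hi).2
      have h1 := (hS t i j f hx).2.2 k (Finset.mem_filter.1 hk).1 hik.symm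
      have h2 := hopDist_triangle k i j
      rw [hopDist_comm k i] at h2
      simp only at hlen
      omega
    have hcs : ((A.filter short).card : ℝ) ≤ (8 * K + 2) ^ 2 := by
      have h1 := card_le_of_separated hsep
      have h2 : ((L / (r / 2 / 2 + 1) : ℕ) : ℝ) ≤ 4 * K := by
        refine Nat.cast_div_le.trans ?_
        rw [div_le_iff₀ (by positivity)]
        have h3 : (r : ℝ) ≤ 4 * ((r / 2 / 2 + 1 : ℕ) : ℝ) := by
          have : r ≤ 4 * (r / 2 / 2 + 1) := by omega
          exact_mod_cast this
        calc (L : ℝ) ≤ K * r := hLK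
          _ ≤ K * (4 * ((r / 2 / 2 + 1 : ℕ) : ℝ)) := by gcongr
          _ = _ := by ring
      calc ((A.filter short).card : ℝ) ≤ ((2 * (L / (r / 2 / 2 + 1)) + 2) ^ 2 : ℕ) := by
            exact_mod_cast h1
        _ = (2 * ((L / (r / 2 / 2 + 1) : ℕ) : ℝ) + 2) ^ 2 := by push_cast; ring
        _ ≤ (2 * (4 * K) + 2) ^ 2 := by gcongr
        _ = _ := by ring
    have hcl : ((A.filter fun i => ¬ short i).card : ℝ) * (F * (W * r) / A.card) ≤ F * (W * r) := by
      have h1 : ((A.filter fun i => ¬ short i).card : ℝ) ≤ A.card := by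
        exact_mod_cast Finset.card_filter_le _ _
      rcases (Nat.cast_nonneg (α := ℝ) A.card).eq_or_lt with h0 | h0
      · rw [← h0]; simp; positivity
      · rw [mul_div_assoc', div_le_iff₀ h0, mul_comm]
        gcongr
    calc _ ≤ (8 * K + 2) ^ 2 * (E * (W * r)) + F * (W * r) := by gcongr
      _ = _ := by ring

end Converse

/-! ### Routes -/

section Routes

variable {L r : ℕ}

theorem linkGraph_adj {i j : Cell L} :
    (linkGraph L r).Adj i j ↔ i ≠ j ∧ hopDist i j ≤ r := by
  rw [linkGraph, SimpleGraph.fromRel_adj, hopDist_comm j i, or_self]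

theorem hexNorm_zsmul {u : ℤ × ℤ} (hu : u = (0, 1) ∨ u = (1, 0) ∨ u = (1, -1)) (t : ℤ) :
    hexNorm (t • u) = t.natAbs := by
  rcases hu with rfl | rfl | rfl <;> simp [hexNorm]

/-- The hexagon is convex, so a lattice segment with both ends in it stays inside. -/
theorem add_zsmul_mem_cells {u : ℤ × ℤ} (hu : u = (0, 1) ∨ u = (1, 0) ∨ u = (1, -1)) {p : ℤ × ℤ}
    {s t : ℤ} (hp : p ∈ cells L) (hq : p + t • u ∈ cells L)
    (hs : 0 ≤ s ∧ s ≤ t ∨ t ≤ s ∧ s ≤ 0) : p + s • u ∈ cells L := by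
  rw [mem_cells, hexNorm_le_iff] at *
  rcases hu with rfl | rfl | rfl <;>
    simp only [Prod.fst_add, Prod.snd_add, Prod.smul_fst, Prod.smul_snd, smul_eq_mul] at * <;>
    omega

/-- A walk with steps of `r` hops along a line of cells. -/
theorem exists_walk_of_eq_add_zsmul {u : ℤ × ℤ} (hu : u = (0, 1) ∨ u = (1, 0) ∨ u = (1, -1))
    (hr : 1 ≤ r) (p q : Cell L) (t : ℤ) (h : q.1 = p.1 + t • u) :
    ∃ w : (linkGraph L r).Walk p q, (∀ v ∈ w.support, ∃ s : ℤ, v.1 = p.1 + s • u) ∧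
      w.length * r ≤ t.natAbs + r := by
  induction hn : t.natAbs using Nat.strong_induction_on generalizing p t with
  | _ n ih =>
    have hd : hopDist p q = t.natAbs := by
      rw [hopDist, h, sub_add_cancel_left, hexNorm_neg, hexNorm_zsmul hu]
    by_cases hle : t.natAbs ≤ r
    · rcases eq_or_ne p q with rfl | hpq
      · exact ⟨.nil, by simpa using ⟨0, by simp⟩, by simp⟩
      · refine ⟨(linkGraph_adj.2 ⟨hpq, hd.trans_le hle⟩).toWalk, ?_, by simp⟩
        intro v hv
        simp only [SimpleGraph.Adj.toWalk, SimpleGraph.Walk.support_cons,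
          SimpleGraph.Walk.support_nil, List.mem_cons, List.not_mem_nil, or_false] at hv
        rcases hv with rfl | rfl
        · exact ⟨0, by simp⟩
        · exact ⟨t, h⟩
    · obtain ⟨s, hs, hs1, hs2⟩ : ∃ s : ℤ, (0 ≤ s ∧ s ≤ t ∨ t ≤ s ∧ s ≤ 0) ∧ s.natAbs = r ∧
          (t - s).natAbs + r = t.natAbs := by
        rcases le_total 0 t with h0 | h0
        · exact ⟨r, by omega⟩
        · exact ⟨-r, by omega⟩
      set p' : Cell L := ⟨p.1 + s • u, add_zsmul_mem_cells hu p.2 (h ▸ q.2) hs⟩ with hp'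
      have hdp : hopDist p p' = r := by
        rw [hopDist, hp', sub_add_cancel_left, hexNorm_neg, hexNorm_zsmul hu, hs1]
      have hne : p ≠ p' := by
        intro he
        rw [← he, hopDist_self] at hdp
        omega
      obtain ⟨w, hw, hlen⟩ := ih (t - s).natAbs (by omega) p' (t - s)
        (by rw [h, hp', add_assoc, ← add_smul]; congr 2; ring) rfl
      refine ⟨.cons (linkGraph_adj.2 ⟨hne, hdp.le⟩) w, ?_, ?_⟩
      · intro v hv
        rw [SimpleGraph.Walk.support_cons, List.mem_cons] at hv
        rcases hv with rfl | hv
        · exact ⟨0, by simp⟩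
        · obtain ⟨s', hs'⟩ := hw v hv
          exact ⟨s + s', by rw [hs', hp', add_assoc, ← add_smul]⟩
      · rw [SimpleGraph.Walk.length_cons, add_mul]
        omega

/-- The walk stays on the common line of `p` and `q`. Both memberships are kept because one leg of a
route is charged to its source, the other to its destination. -/
theorem exists_walk_of_mem_lines (hr : 1 ≤ r) {p q : Cell L} (h : q ∈ lines p) :
    ∃ w : (linkGraph L r).Walk p q, (∀ v ∈ w.support, v ∈ lines p ∧ v ∈ lines q) ∧
      w.length * r ≤ 2 * L + r := by
  have hp := hexNorm_le_iff.1 (mem_cells.1 p.2)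
  have hq := hexNorm_le_iff.1 (mem_cells.1 q.2)
  rw [mem_lines] at h
  rcases h with h | h | h
  · have he : q.1 = p.1 + (q.1.2 - p.1.2) • ((0, 1) : ℤ × ℤ) := by ext <;> simp [h]
    obtain ⟨w, hw, hl⟩ := exists_walk_of_eq_add_zsmul (.inl rfl) hr p q _ he
    refine ⟨w, fun v hv => ?_, hl.trans (by omega)⟩
    obtain ⟨s, hs⟩ := hw v hv
    rw [mem_lines, mem_lines, hs, h]
    simp
  · have he : q.1 = p.1 + (q.1.1 - p.1.1) • ((1, 0) : ℤ × ℤ) := by ext <;> simp [h]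
    obtain ⟨w, hw, hl⟩ := exists_walk_of_eq_add_zsmul (.inr (.inl rfl)) hr p q _ he
    refine ⟨w, fun v hv => ?_, hl.trans (by omega)⟩
    obtain ⟨s, hs⟩ := hw v hv
    rw [mem_lines, mem_lines, hs, h]
    simp
  · have he : q.1 = p.1 + (q.1.1 - p.1.1) • ((1, -1) : ℤ × ℤ) := by
      ext
      · simp
      · simp; linarith
    obtain ⟨w, hw, hl⟩ := exists_walk_of_eq_add_zsmul (.inr (.inr rfl)) hr p q _ he
    refine ⟨w, fun v hv => ?_, hl.trans (by omega)⟩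
    obtain ⟨s, hs⟩ := hw v hv
    have hv : v.1.1 + v.1.2 = p.1.1 + p.1.2 := by rw [hs]; simp; ring
    rw [mem_lines, mem_lines, hv, h]
    simp

/-- Some line through p meets some line through q at a point whose three coordinates all lie between
those of p and q; such a point cannot leave the hexagon. -/
theorem exists_mem_lines_mem_lines (p q : Cell L) : ∃ c : Cell L, c ∈ lines p ∧ c ∈ lines q := by
  have hp := hexNorm_le_iff.1 (mem_cells.1 p.2)
  have hq := hexNorm_le_iff.1 (mem_cells.1 q.2)
  obtain ⟨⟨x, y⟩, hp'⟩ := p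
  obtain ⟨⟨x', y'⟩, hq'⟩ := q
  simp only at hp hq
  obtain ⟨c, hc, h1, h2⟩ : ∃ c : ℤ × ℤ, hexNorm c ≤ L ∧
      (c.1 = x ∨ c.2 = y ∨ c.1 + c.2 = x + y) ∧ (c.1 = x' ∨ c.2 = y' ∨ c.1 + c.2 = x' + y') := by
    rcases le_total x x' with h | h <;> rcases le_total y y' with h' | h' <;>
      rcases le_total (x + y) (x' + y') with h'' | h''
    · exact ⟨(x', y), hexNorm_le_iff.2 (by simp only; omega), by simp, by simp⟩
    · exact ⟨(x', y), hexNorm_le_iff.2 (by simp only; omega), by simp, by simp⟩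
    · exact ⟨(x + y - y', y'), hexNorm_le_iff.2 (by simp only; omega), by simp, by simp⟩
    · exact ⟨(x', x + y - x'), hexNorm_le_iff.2 (by simp only; omega), by simp, by simp⟩
    · exact ⟨(x', x + y - x'), hexNorm_le_iff.2 (by simp only; omega), by simp, by simp⟩
    · exact ⟨(x + y - y', y'), hexNorm_le_iff.2 (by simp only; omega), by simp, by simp⟩
    · exact ⟨(x', y), hexNorm_le_iff.2 (by simp only; omega), by simp, by simp⟩
    · exact ⟨(x', y), hexNorm_le_iff.2 (by simp only; omega), by simp, by simp⟩
  exact ⟨⟨c, mem_cells.2 hc⟩, mem_lines.2 h1, mem_lines.2 h2⟩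

/-- Routes that turn at most once, with hops as long as possible. -/
theorem exists_path (hr : 1 ≤ r) (p q : Cell L) : ∃ w : (linkGraph L r).Path p q,
    (∀ v ∈ w.1.support, v ∈ lines p ∨ v ∈ lines q) ∧ w.1.length * r ≤ 4 * L + 2 * r := by
  obtain ⟨c, hcp, hcq⟩ := exists_mem_lines_mem_lines p q
  obtain ⟨w₁, h₁, hl₁⟩ := exists_walk_of_mem_lines hr hcp
  obtain ⟨w₂, h₂, hl₂⟩ := exists_walk_of_mem_lines hr (mem_lines_comm.1 hcq)
  refine ⟨(w₁.append w₂).toPath, ?_, ?_⟩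
  · intro v hv
    have := SimpleGraph.Walk.support_toPath_subset_support _ hv
    rw [SimpleGraph.Walk.mem_support_append_iff] at this
    exact this.imp (fun h => (h₁ v h).1) (fun h => (h₂ v h).2)
  · have h : (w₁.append w₂).toPath.1.length ≤ (w₁.append w₂).length :=
      SimpleGraph.Walk.length_bypass_le_length _
    rw [SimpleGraph.Walk.length_append] at h
    nlinarith

end Routes

/-! ### Schedules -/

section Schedules

variable {L r : ℕ} {X : Placement L} {κ β W : ℝ} {ch : Channel} {d : Cell L → Cell L}

theorem Achievable.mono {R R' : ℝ} (h : Achievable ch W r X d R) (hR : R' ≤ R) :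
    Achievable ch W r X d R' := by
  obtain ⟨S, hS, route, hroute⟩ := h
  exact ⟨S, hS, route, fun f e he => hR.trans (hroute f e he)⟩

/-- Turns an assignment of slots to the hops of the routes into a schedule. Here `σ f i` is the slot
in which node `i` forwards the data of flow `f`, and two different hops may share a slot only if
their transmitters are related by `sep`. -/
theorem achievable_of_slots {Slot : Type*} [Fintype Slot] [Nonempty Slot]
    (route : (f : Cell L) → (linkGraph L r).Path f (d f)) (σ : Cell L → Cell L → Slot)
    (sep : Cell L → Cell L → Prop) (hsep : ∀ i j, sep i j → 2 * r < hopDist i j)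
    (hσ : ∀ f i f' i', i ∈ (route f).1.support → i' ∈ (route f').1.support → σ f i = σ f' i' →
      (f = f' ∧ i = i') ∨ sep i i') {ρ : ℝ} (hρ : 0 ≤ ρ)
    (hrate : ∀ (A : Finset (Cell L)) (i j : Cell L), i ∈ A → i ≠ j → hopDist i j ≤ r →
      (∀ k ∈ A, k ≠ i → sep k i ∧ r < hopDist k j) → ρ ≤ linkRate ch W r X A i j) :
    Achievable ch W r X d (ρ / Fintype.card Slot) := by
  classical
  obtain ⟨e⟩ : Nonempty (Slot ≃ Fin (Fintype.card Slot)) := ⟨Fintype.equivFin Slot⟩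
  -- `P s i x`: the route of flow `x.2` has a hop from `i` to `x.1` assigned to slot `s`.
  obtain ⟨P, hP⟩ : ∃ P : Slot → Cell L → Cell L × Cell L → Prop, ∀ s i x, P s i x ↔
      ∃ a ∈ (route x.2).1.darts, a.fst = i ∧ a.snd = x.1 ∧ σ x.2 i = s := ⟨_, fun _ _ _ => Iff.rfl⟩
  have hstart : ∀ s i x, P s i x → i ∈ (route x.2).1.support ∧ σ x.2 i = s := by
    intro s i x h
    obtain ⟨a, ha, rfl, -, h⟩ := (hP s i x).1 h
    exact ⟨SimpleGraph.Walk.dart_fst_mem_support_of_mem_darts _ ha, h⟩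
  have hPuniq : ∀ s i x y, P s i x → P s i y → x = y := by
    rintro s i ⟨x1, x2⟩ ⟨y1, y2⟩ hx hy
    obtain ⟨h1, h2⟩ := hstart s i _ hx
    obtain ⟨h3, h4⟩ := hstart s i _ hy
    rcases hσ _ _ _ _ h1 h3 (h2.trans h4.symm) with ⟨hf, -⟩ | hs
    · change x2 = y2 at hf
      subst hf
      obtain ⟨a, ha, ha1, ha2, -⟩ := (hP _ _ _).1 hx
      obtain ⟨b, hb, hb1, hb2, -⟩ := (hP _ _ _).1 hy
      have hab := eq_of_mem_darts_of_fst_eq (route x2).2 ha hb (ha1.trans hb1.symm)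
      have : x1 = y1 := by
        subst hab
        exact ha2.symm.trans hb2
      rw [this]
    · have := hsep _ _ hs
      rw [hopDist_self] at this
      exact absurd this (Nat.not_lt_zero _)
  obtain ⟨tx, htx⟩ : ∃ tx : Fin (Fintype.card Slot) → Cell L → Option (Cell L × Cell L),
      ∀ t i x, tx t i = some x ↔ P (e.symm t) i x := by
    refine ⟨fun t i => if h : ∃ x, P (e.symm t) i x then some h.choose else none, ?_⟩
    intro t i x
    beta_reduce
    split_ifs with h
    · rw [Option.some_inj]
      exact ⟨fun hx => hx ▸ h.choose_spec, fun hx => hPuniq _ _ _ _ h.choose_spec hx⟩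
    · exact ⟨fun hx => by simp at hx, fun hx => (h ⟨x, hx⟩).elim⟩
  have hlink : ∀ t i j f, tx t i = some (j, f) → i ≠ j ∧ hopDist i j ≤ r ∧
      ∀ k, (tx t k).isSome → k ≠ i → sep k i ∧ r < hopDist k j := by
    intro t i j f h
    have hp := (htx t i _).1 h
    obtain ⟨h3, h4⟩ := hstart _ _ _ hp
    obtain ⟨a, -, rfl, ha2, -⟩ := (hP _ _ _).1 hp
    change a.snd = j at ha2
    subst ha2
    have hadj := linkGraph_adj.1 a.adj
    refine ⟨hadj.1, hadj.2, fun k hk hki => ?_⟩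
    obtain ⟨y, hy⟩ := Option.isSome_iff_exists.1 hk
    obtain ⟨h1, h2⟩ := hstart _ _ _ ((htx t k y).1 hy)
    have hs : sep k a.fst := (hσ _ _ _ _ h1 h3 (h2.trans h4.symm)).resolve_left
      fun hc => hki hc.2
    refine ⟨hs, ?_⟩
    -- Transmitters more than 2r apart, with receivers within r of their own transmitter, are more
    -- than r from each other's receivers.
    have h5 := hsep _ _ hs
    have h6 := hopDist_triangle k a.snd a.fst
    have h7 := hadj.2
    rw [hopDist_comm a.snd] at h6
    omega
  set S : Schedule L := ⟨Fintype.card Slot, Fintype.card_pos, tx⟩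
  have hact : ∀ t k, k ∈ S.active t ↔ (tx t k).isSome := fun t k => by
    simp [Schedule.active, S]
  have hlinkRate : ∀ t i j f, tx t i = some (j, f) →
      ρ ≤ linkRate ch W r X (S.active t) i j := by
    intro t i j f h
    obtain ⟨h1, h2, h3⟩ := hlink t i j f h
    exact hrate _ _ _ ((hact t i).2 (by rw [h]; rfl)) h1 h2 fun k hk => h3 k ((hact t k).1 hk)
  refine ⟨S, fun t i j f h => ?_, route, fun f a ha => ?_⟩
  · obtain ⟨h1, h2, h3⟩ := hlink t i j f h
    exact ⟨h1, h2, fun k hk hki => (h3 k ((hact t k).1 hk) hki).2⟩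
  have ht : tx (e (σ f a.fst)) a.fst = some (a.snd, f) :=
    (htx _ _ _).2 ((hP _ _ _).2 ⟨a, ha, rfl, rfl, (e.symm_apply_apply _).symm⟩)
  unfold Schedule.carried
  refine div_le_div_of_nonneg_right ?_ (Nat.cast_nonneg _)
  calc ρ ≤ linkRate ch W r X (S.active (e (σ f a.fst))) a.fst a.snd := hlinkRate _ _ _ _ ht
    _ = if S.tx (e (σ f a.fst)) a.fst = some (a.snd, f) then
          linkRate ch W r X (S.active (e (σ f a.fst))) a.fst a.snd else 0 := (if_pos ht).symm
    _ ≤ _ := by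
        refine Finset.single_le_sum (f := fun t => if S.tx t a.fst = some (a.snd, f) then
          linkRate ch W r X (S.active t) a.fst a.snd else 0) (fun t _ => ?_) (Finset.mem_univ _)
        split_ifs with h
        · exact hρ.trans (hlinkRate _ _ _ _ h)
        · exact le_rfl

/-- Long hops: one transmission at a time. -/
theorem HopBounds.achievable_of_long_range (hX : HopBounds κ β X) (hκ : 0 < κ)
    (hgain : 0 < ch.gain) (hT : 0 < ch.threshold) (hη : 0 < ch.noise) (hα : 0 ≤ ch.pathLoss)
    (hW : 0 ≤ W) {K : ℝ} (hr : 1 ≤ r) (hLK : L ≤ K * r) (d : Cell L → Cell L) :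
    Achievable ch W r X d (W * Real.logb 2 (1 + ch.threshold / ch.noise) /
      (numNodes L * (4 * K + 4))) := by
  classical
  choose route hroute hlen using fun f => exists_path hr f (d f)
  have hr0 : (0 : ℝ) < r := by exact_mod_cast hr
  -- A route has at most (4L+2r)/r ≤ 4K+2 hops. Slots are pairs (flow, position on its route), and H
  -- hops mean H+1 positions.
  set H := ⌊4 * K + 2⌋₊ with hH
  have hK : 0 ≤ K := by
    by_contra! h
    have : (0 : ℝ) ≤ L := Nat.cast_nonneg L
    nlinarith
  have hlen' : ∀ f, (route f).1.length ≤ H := by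
    intro f
    apply Nat.le_floor
    have h1 : ((route f).1.length : ℝ) * r ≤ 4 * L + 2 * r := by exact_mod_cast hlen f
    have h2 : ((route f).1.length : ℝ) * r ≤ (4 * K + 2) * r := by linarith
    exact le_of_mul_le_mul_right h2 hr0
  have hpos : 0 < numNodes L := lt_of_lt_of_le (by positivity) (sq_le_numNodes L)
  have : Nonempty (Cell L) := Fintype.card_pos_iff.1 hpos
  have hidx : ∀ f i, i ∈ (route f).1.support → (route f).1.support.idxOf i < H + 1 := by
    intro f i hi
    have h1 := List.idxOf_lt_length_iff.2 hi
    rw [SimpleGraph.Walk.length_support] at h1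
    have := hlen' f
    omega
  have hrate0 : 0 ≤ W * Real.logb 2 (1 + ch.threshold / ch.noise) :=
    mul_nonneg hW (Real.logb_nonneg one_lt_two (le_add_of_nonneg_right (by positivity)))
  have key := achievable_of_slots (X := X) (ch := ch) (W := W) route
    (Slot := Cell L × Fin (H + 1))
    (fun f i => (f, Fin.ofNat (H + 1) ((route f).1.support.idxOf i))) (fun _ _ => False)
    (fun _ _ h => h.elim) (by
      intro f i f' i' hi hi' h
      obtain ⟨rfl, h2⟩ := Prod.mk.inj h
      refine .inl ⟨rfl, ?_⟩
      have h3 := congrArg Fin.val h2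
      simp only [Fin.val_ofNat] at h3
      rw [Nat.mod_eq_of_lt (hidx f i hi), Nat.mod_eq_of_lt (hidx f i' hi')] at h3
      exact (List.idxOf_inj hi).1 h3) hrate0 (by
      intro A i j hi hij hle hA
      have hAe : A.erase i = ∅ := by
        rw [Finset.eq_empty_iff_forall_notMem]
        intro k hk
        exact (hA k (Finset.mem_of_mem_erase hk) (Finset.ne_of_mem_erase hk)).1
      have := hX.le_linkRate (A := A) (I := 0) hκ hgain hT hη hα hW hij hle (by simp [hAe])
      simpa using this)
  refine key.mono ?_
  rw [Fintype.card_prod, Fintype.card_fin]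
  change _ ≤ _ / ((numNodes L * (H + 1) : ℕ) : ℝ)
  push_cast
  have : (H : ℝ) ≤ 4 * K + 2 := Nat.floor_le (by linarith)
  refine div_le_div_of_nonneg_left hrate0 (mul_pos (by exact_mod_cast hpos) (by positivity)) ?_
  refine mul_le_mul_of_nonneg_left ?_ (Nat.cast_nonneg _)
  linarith

/-- The interference from nodes at all the cells other than the receiver is bounded when the path
loss exponent exceeds two. -/
theorem HopBounds.sum_rxPower_le (hX : HopBounds κ β X) (hκ : 0 < κ) (hβ : 0 ≤ β)
    (hgain : 0 < ch.gain) (hT : 0 < ch.threshold) (hα : 2 < ch.pathLoss) {ρ : ℕ} (hρ : r ≤ ρ)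
    {A : Finset (Cell L)} {j : Cell L} (hA : ∀ k ∈ A, k ≠ j) :
    ∑ k ∈ A, rxPower ch r X k j ≤ ch.threshold * (β * ρ / κ) ^ ch.pathLoss *
      ∑' x : Fin 2 → ℤ, ‖x‖ ^ (-ch.pathLoss) := by
  classical
  have hsum := EisensteinSeries.summable_one_div_norm_rpow hα
  -- The offset from the receiver embeds the cells in ℤ², where the sup norm is at most the hop
  -- distance; the sum is then dominated by the full lattice sum.
  set φ : Cell L → (Fin 2 → ℤ) := fun k => ![k.1.1 - j.1.1, k.1.2 - j.1.2] with hφ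
  have hinj : Function.Injective φ := by
    intro k l h
    have h0 := congrFun h 0
    have h1 := congrFun h 1
    simp only [hφ, Matrix.cons_val_zero, Matrix.cons_val_one] at h0 h1
    exact Subtype.ext (Prod.ext (by linarith) (by linarith))
  have hterm : ∀ k ∈ A, rxPower ch r X k j ≤
      ch.threshold * (β * ρ / κ) ^ ch.pathLoss * ‖φ k‖ ^ (-ch.pathLoss) := by
    intro k hk
    have hne := hA k hk
    have hh : (0 : ℝ) < hopDist k j := by exact_mod_cast one_le_hopDist hne
    have hle : ‖φ k‖ ≤ hopDist k j := by
      rw [pi_norm_le_iff_of_nonneg hh.le]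
      obtain ⟨h1, h2, -⟩ := hexNorm_le_iff.1 (le_refl (hopDist k j))
      intro t
      fin_cases t
      · simp only [hφ, Fin.zero_eta, Matrix.cons_val_zero, Int.norm_eq_abs]
        rw [abs_le]
        exact_mod_cast h1
      · simp only [hφ, Fin.mk_one, Matrix.cons_val_one, Int.norm_eq_abs]
        rw [abs_le]
        exact_mod_cast h2
    have hpos : 0 < ‖φ k‖ := by
      rw [norm_pos_iff]
      intro h0
      refine hne (hinj (h0.trans ?_))
      ext t
      fin_cases t <;> simp [hφ]
    have hα0 : 0 ≤ ch.pathLoss := by linarith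
    calc rxPower ch r X k j ≤ ch.threshold * (β * r / (κ * hopDist k j)) ^ ch.pathLoss :=
          hX.rxPower_le hκ hβ hgain hT hα0 hne
      _ ≤ ch.threshold * (β * ρ / (κ * ‖φ k‖)) ^ ch.pathLoss := by gcongr
      _ = _ := by
          rw [← div_div, Real.div_rpow (by positivity) (by positivity), Real.rpow_neg hpos.le]
          ring
  calc ∑ k ∈ A, rxPower ch r X k j
      ≤ ∑ k ∈ A, ch.threshold * (β * ρ / κ) ^ ch.pathLoss * ‖φ k‖ ^ (-ch.pathLoss) :=
        Finset.sum_le_sum hterm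
    _ = ch.threshold * (β * ρ / κ) ^ ch.pathLoss *
          ∑ x ∈ A.image φ, ‖x‖ ^ (-ch.pathLoss) := by
        rw [← Finset.mul_sum, Finset.sum_image hinj.injOn]
    _ ≤ _ := by
        gcongr
        exact hsum.sum_le_tsum _ fun x _ => by positivity

/-- Short hops: cells whose coordinates agree modulo `2 * r + 1` transmit simultaneously. -/
theorem HopBounds.achievable_of_short_range (hX : HopBounds κ β X) (hκ : 0 < κ) (hβ : 0 ≤ β)
    (hgain : 0 < ch.gain) (hT : 0 < ch.threshold) (hη : 0 < ch.noise) (hα : 2 < ch.pathLoss)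
    (hW : 0 ≤ W) {ρ : ℕ} (hr : 1 ≤ r) (hρ : r ≤ ρ) (hL : 1 ≤ L) {d : Cell L → Cell L}
    (hd : ∀ v, (Finset.univ.filter fun f => d f ∈ lines v).card < 36 * L) :
    Achievable ch W r X d (W * Real.logb 2 (1 + ch.threshold / (ch.noise +
      ch.threshold * (β * ρ / κ) ^ ch.pathLoss * ∑' x : Fin 2 → ℤ, ‖x‖ ^ (-ch.pathLoss))) /
        ((2 * ρ + 1) ^ 2 * (45 * L))) := by
  classical
  set I := ch.threshold * (β * ρ / κ) ^ ch.pathLoss * ∑' x : Fin 2 → ℤ, ‖x‖ ^ (-ch.pathLoss)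
    with hI
  have hI0 : 0 ≤ I := mul_nonneg (by positivity) (tsum_nonneg fun x => by positivity)
  choose route hroute hlen using fun f => exists_path hr f (d f)
  -- At most 3(2L+1) ≤ 9L flows have their source on the lines of `v`, and fewer than 36L their
  -- destination.
  have hload : ∀ v, (Finset.univ.filter fun f => v ∈ (route f).1.support).card ≤ 45 * L := by
    intro v
    have h1 : (Finset.univ.filter fun f => v ∈ (route f).1.support) ⊆
        lines v ∪ Finset.univ.filter fun f => d f ∈ lines v := by
      intro f hf
      rw [Finset.mem_union]
      refine (hroute f v (Finset.mem_filter.1 hf).2).imp mem_lines_comm.1 fun h => ?_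
      simpa using mem_lines_comm.1 h
    have h2 := (Finset.card_le_card h1).trans (Finset.card_union_le _ _)
    have h3 := card_lines_le v
    have h4 := hd v
    omega
  have : NeZero (45 * L) := ⟨by omega⟩
  -- Each cell numbers the flows it relays; different cells need no coordination, since the residue
  -- class already separates them.
  have hex : ∀ v, ∃ g : Cell L → Fin (45 * L),
      Set.InjOn g {f | v ∈ (route f).1.support} := by
    intro v
    obtain ⟨g⟩ := Function.Embedding.nonempty_of_card_le
      (α := Finset.univ.filter fun f => v ∈ (route f).1.support) (β := Fin (45 * L))
      (by rw [Fintype.card_coe, Fintype.card_fin]; exact hload v)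
    refine ⟨fun f => if h : f ∈ Finset.univ.filter fun f => v ∈ (route f).1.support
      then g ⟨f, h⟩ else 0, ?_⟩
    intro f hf f' hf' h
    have hf : f ∈ Finset.univ.filter fun f => v ∈ (route f).1.support := by simpa using hf
    have hf' : f' ∈ Finset.univ.filter fun f => v ∈ (route f).1.support := by simpa using hf'
    simp only [dif_pos hf, dif_pos hf'] at h
    exact congrArg Subtype.val (g.injective h)
  choose g hg using hex
  have hrate0 : 0 ≤ W * Real.logb 2 (1 + ch.threshold / (ch.noise + I)) :=
    mul_nonneg hW (Real.logb_nonneg one_lt_two (le_add_of_nonneg_right (by positivity)))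
  have hmod : ∀ x y : ℤ, (x : ZMod (2 * r + 1)) = y → x ≠ y → 2 * r < (x - y).natAbs := by
    intro x y h hne
    rw [ZMod.intCast_eq_intCast_iff_dvd_sub] at h
    have h1 := Int.le_of_dvd (abs_pos.2 (sub_ne_zero.2 hne.symm)) ((dvd_abs _ _).2 h)
    rw [abs_sub_comm, Int.abs_eq_natAbs] at h1
    omega
  have key := achievable_of_slots (X := X) (ch := ch) (W := W) route
    (Slot := (ZMod (2 * r + 1) × ZMod (2 * r + 1)) × Fin (45 * L))
    (fun f i => (((i.1.1 : ZMod (2 * r + 1)), (i.1.2 : ZMod (2 * r + 1))), g i f))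
    (fun i j => 2 * r < hopDist i j) (fun _ _ h => h) (by
      intro f i f' i' hi hi' h
      obtain ⟨h1, h2⟩ := Prod.mk.inj h
      obtain ⟨h3, h4⟩ := Prod.mk.inj h1
      rcases eq_or_ne i i' with rfl | hne
      · exact .inl ⟨hg i hi hi' h2, rfl⟩
      · right
        have hx : i.1.1 ≠ i'.1.1 ∨ i.1.2 ≠ i'.1.2 := by
          by_contra! hc
          exact hne (Subtype.ext (Prod.ext hc.1 hc.2))
        rcases hx with hx | hx
        · refine (hmod _ _ h3 hx).trans_le ?_
          exact (le_max_left _ _).trans (le_max_left _ _)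
        · refine (hmod _ _ h4 hx).trans_le ?_
          exact (le_max_right _ _).trans (le_max_left _ _)) hrate0 (by
      intro A i j hi hij hle hA
      refine hX.le_linkRate hκ hgain hT hη (by linarith) hW hij hle ?_
      refine hX.sum_rxPower_le hκ hβ hgain hT hα hρ fun k hk => ?_
      rintro rfl
      have := (hA k (Finset.mem_of_mem_erase hk) (Finset.ne_of_mem_erase hk)).2
      simp at this)
  refine key.mono ?_
  rw [Fintype.card_prod, Fintype.card_prod, ZMod.card, Fintype.card_fin, ← sq]
  push_cast
  have hL0 : (0 : ℝ) < L := by exact_mod_cast hL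
  gcongr

end Schedules

/-! ### The order of the throughput -/

theorem tendsto_exceptional_far :
    Tendsto (fun L => ENNReal.ofReal ((3 / 4) ^ (numNodes L / 4))) atTop (𝓝 0) := by
  rw [← ENNReal.ofReal_zero]
  refine (ENNReal.continuous_ofReal.tendsto 0).comp ?_
  refine (tendsto_pow_atTop_nhds_zero_of_lt_one (by norm_num) (by norm_num)).comp ?_
  refine tendsto_atTop_mono (fun L => ?_) (Nat.tendsto_div_const_atTop (n := 4) (by norm_num))
  refine Nat.div_le_div_right ?_
  have := sq_le_numNodes L
  nlinarith

theorem tendsto_exceptional_load :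
    Tendsto (fun L : ℕ => ENNReal.ofReal (9 * (L : ℝ) ^ 2 * (3 / 4) ^ L)) atTop (𝓝 0) := by
  rw [← ENNReal.ofReal_zero]
  refine (ENNReal.continuous_ofReal.tendsto 0).comp ?_
  have := (tendsto_pow_const_mul_const_pow_of_abs_lt_one 2
    (show |(3 / 4 : ℝ)| < 1 by rw [abs_of_pos] <;> norm_num)).const_mul 9
  simpa [mul_assoc] using this

theorem le_sqrt_numNodes (L : ℕ) : (L : ℝ) ≤ √(numNodes L : ℝ) := by
  apply Real.le_sqrt_of_sq_le
  have : L ^ 2 ≤ numNodes L := (Nat.pow_le_pow_left (Nat.le_succ L) 2).trans (sq_le_numNodes L)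
  exact_mod_cast this

theorem sqrt_numNodes_le {L : ℕ} (hL : 1 ≤ L) : √(numNodes L : ℝ) ≤ 3 * L := by
  rw [Real.sqrt_le_left (by positivity)]
  have : numNodes L ≤ (3 * L) ^ 2 := by have := numNodes_le_sq L; nlinarith
  exact_mod_cast this

/-- If, for large `L`, the throughput `c * W * g n` is achievable for all placements within the
perturbation range unless some cell is on the lines of too many destinations, and if all slots make
progress at most `B * W * n * L * g n`, then the throughput has order `g`. -/
theorem throughputHasOrder_of_bounds {a δ : ℝ} (ha : 0 < a) (hδ₀ : 0 ≤ δ) (hδ : δ < √3 / 2 * a)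
    {ch : Channel} (hgain : 0 < ch.gain) (hT : 0 < ch.threshold) (hη : 0 < ch.noise)
    {r : ℕ → ℕ} {g : ℝ → ℝ} (hg : ∀ᶠ L in atTop, 0 < g (numNodes L)) {c B : ℝ} (hc : 0 < c)
    (hB : 0 ≤ B)
    (hach : ∀ᶠ L in atTop, ∀ W, 0 < W → ∀ X : Placement L,
      HopBounds ((√3 * a - 2 * δ) / 2) (2 * √3 * a) X → ∀ d : Cell L → Cell L,
      (∀ v, (Finset.univ.filter fun f => d f ∈ lines v).card < 36 * L) →
      Achievable ch W (r L) X d (c * (W * g (numNodes L))))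
    (hconv : ∀ᶠ L in atTop, ∀ W, 0 < W → ∀ X : Placement L,
      HopBounds ((√3 * a - 2 * δ) / 2) (2 * √3 * a) X → ∀ S : Schedule L, S.Admissible (r L) →
      ∀ t, S.progress ch W (r L) X t ≤ B * (W * g (numNodes L)) * (numNodes L * L)) :
    ThroughputHasOrder.{u} a δ ch r g := by
  -- Distances typically sum to at least nL/32, so 32B is the critical constant; the extra 1 makes
  -- the contradiction strict.
  refine ⟨c, 32 * B + 1, hc, by positivity, ?_⟩
  intro W hW Ω _ μ _ D X hD hX
  have hnull : ∀ L, μ L {ω | ¬ ∀ i, dist (X L ω i) (center a i.1) ≤ δ} = 0 :=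
    fun L => ae_iff.1 (hX L)
  constructor
  · refine tendsto_of_tendsto_of_tendsto_of_le_of_le' tendsto_const_nhds
      tendsto_exceptional_load (Eventually.of_forall fun _ => zero_le) ?_
    filter_upwards [hach, eventually_ge_atTop 1] with L hL hL1
    calc _ ≤ μ L ({ω | ∃ v, 36 * L ≤ (Finset.univ.filter fun f => D L f ω ∈ lines v).card} ∪
          {ω | ¬ ∀ i, dist (X L ω i) (center a i.1) ≤ δ}) := by
          -- Only monotonicity and subadditivity are used, so the event need not be measurable.
          refine measure_mono fun ω hω => ?_
          by_contra hcon
          rw [Set.mem_union, not_or, Set.mem_ofPred_eq, Set.mem_ofPred_eq, not_not] at hcon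
          refine hω (hL W hW _ (hopBounds_of_dist_center_le ha hδ₀ hδ hcon.2) _ fun v => ?_)
          by_contra hv
          exact hcon.1 ⟨v, not_lt.1 hv⟩
      _ ≤ _ + _ := measure_union_le _ _
      _ ≤ _ := by
          rw [hnull, add_zero]
          exact (hD L).measure_exists_card_lines_le hL1
  · refine tendsto_of_tendsto_of_tendsto_of_le_of_le' tendsto_const_nhds
      tendsto_exceptional_far (Eventually.of_forall fun _ => zero_le) ?_
    filter_upwards [hconv, hg, eventually_ge_atTop 8] with L hL hgL hL8
    calc _ ≤ μ L ({ω | 32 * (∑ f, (hopDist f (D L f ω) : ℝ)) < numNodes L * L} ∪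
          {ω | ¬ ∀ i, dist (X L ω i) (center a i.1) ≤ δ}) := by
          refine measure_mono fun ω hω => ?_
          by_contra hcon
          rw [Set.mem_union, not_or, Set.mem_ofPred_eq, Set.mem_ofPred_eq, not_not, not_lt] at hcon
          have hR : 0 < W * g (numNodes L) := mul_pos hW hgL
          have h1 := mul_sum_hopDist_le_of_achievable (mul_nonneg (by positivity) hR.le) hgain hT hη
            hW.le (hL W hW _ (hopBounds_of_dist_center_le ha hδ₀ hδ hcon.2)) hω
          have h2 := hcon.1
          have hn : (0 : ℝ) < numNodes L * L := by
            have h3 := sq_le_numNodes L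
            have : 0 < numNodes L * L := Nat.mul_pos (by nlinarith) (by omega)
            exact_mod_cast this
          have h4 : (32 * B + 1) * (W * g (numNodes L)) * (numNodes L * L) ≤
              32 * (B * (W * g (numNodes L)) * (numNodes L * L)) := by
            calc _ ≤ (32 * B + 1) * (W * g (numNodes L)) *
                    (32 * ∑ f, (hopDist f (D L f ω) : ℝ)) := by gcongr
              _ = 32 * ((32 * B + 1) * (W * g (numNodes L)) *
                    ∑ f, (hopDist f (D L f ω) : ℝ)) := by ring
              _ ≤ _ := by gcongr
          have h5 : 0 < W * g (numNodes L) * (numNodes L * L) := mul_pos hR hn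
          nlinarith
      _ ≤ _ + _ := measure_union_le _ _
      _ ≤ _ := by
          rw [hnull, add_zero]
          exact (hD L).measure_sum_hopDist_lt_le hL8

theorem throughputHasOrder_of_short_range {a δ : ℝ} (ha : 0 < a) (hδ₀ : 0 ≤ δ)
    (hδ : δ < √3 / 2 * a) {ch : Channel} (hgain : 0 < ch.gain) (hT : 0 < ch.threshold)
    (hη : 0 < ch.noise) (hα : 2 < ch.pathLoss) {r : ℕ → ℕ} {ρ : ℕ}
    (hr : ∀ᶠ L in atTop, 1 ≤ r L ∧ r L ≤ ρ) :
    ThroughputHasOrder.{u} a δ ch r (fun n => 1 / √n) := by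
  have hκ : 0 < (√3 * a - 2 * δ) / 2 := by linarith
  have hβ : 0 < 2 * √3 * a := by positivity
  generalize hκe : (√3 * a - 2 * δ) / 2 = κ at *
  generalize hβe : 2 * √3 * a = β at *
  set I := ch.threshold * (β * ρ / κ) ^ ch.pathLoss * ∑' x : Fin 2 → ℤ, ‖x‖ ^ (-ch.pathLoss)
    with hI
  have hI0 : 0 ≤ I := mul_nonneg (by positivity) (tsum_nonneg fun x => by positivity)
  have hlog2 := Real.log_pos one_lt_two
  have hα0 : 0 ≤ ch.pathLoss := by linarith
  set E := (Real.log (1 + ch.threshold * (β / κ) ^ ch.pathLoss / ch.noise) + ch.pathLoss) /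
    Real.log 2 with hE
  have hE0 : 0 ≤ E := by
    have : 0 ≤ Real.log (1 + ch.threshold * (β / κ) ^ ch.pathLoss / ch.noise) :=
      Real.log_nonneg (le_add_of_nonneg_right (by positivity))
    positivity
  have hrate : 0 < Real.logb 2 (1 + ch.threshold / (ch.noise + I)) :=
    Real.logb_pos one_lt_two (lt_add_of_pos_right _ (by positivity))
  refine throughputHasOrder_of_bounds ha hδ₀ hδ hgain hT hη
    (c := Real.logb 2 (1 + ch.threshold / (ch.noise + I)) / ((2 * ρ + 1) ^ 2 * 45))
    (B := E * ρ * 3) ?_ (by positivity) (by positivity) ?_ ?_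
  · filter_upwards [eventually_ge_atTop 1] with L hL
    have : (0 : ℝ) < √(numNodes L) := lt_of_lt_of_le (by exact_mod_cast hL) (le_sqrt_numNodes L)
    positivity
  · filter_upwards [hr, eventually_ge_atTop 1] with L hrL hL W hW X hX d hd
    rw [hκe, hβe] at hX
    refine (hX.achievable_of_short_range hκ hβ.le hgain hT hη hα hW.le hrL.1 hrL.2 hL hd).mono ?_
    rw [← hI]
    have hL0 : (0 : ℝ) < L := by exact_mod_cast hL
    have h1 := le_sqrt_numNodes L
    calc _ ≤ Real.logb 2 (1 + ch.threshold / (ch.noise + I)) / ((2 * ρ + 1) ^ 2 * 45) *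
          (W * (1 / L)) := by gcongr
      _ = _ := by field_simp
  · filter_upwards [hr, eventually_ge_atTop 1] with L hrL hL W hW X hX S hS t
    rw [hκe, hβe] at hX
    refine (hX.progress_le_of_all hκ hβ.le hgain hT hη hα0 hW.le hS t).trans ?_
    rw [← hE]
    have h0 : (0 : ℝ) < √(numNodes L) := lt_of_lt_of_le (by exact_mod_cast hL) (le_sqrt_numNodes L)
    -- The factor 3 comes from √n ≤ 3L and converts the progress bound of order n into n·L/√n.
    have h1 : 1 ≤ 3 * (1 / √(numNodes L : ℝ)) * L := by
      rw [mul_one_div, div_mul_eq_mul_div, one_le_div h0]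
      exact sqrt_numNodes_le hL
    have h2 : (r L : ℝ) ≤ ρ := by exact_mod_cast hrL.2
    calc (numNodes L : ℝ) * (E * (W * r L)) ≤ (numNodes L : ℝ) * (E * (W * ρ)) * 1 := by
          rw [mul_one]; gcongr
      _ ≤ (numNodes L : ℝ) * (E * (W * ρ)) * (3 * (1 / √(numNodes L : ℝ)) * L) := by gcongr
      _ = _ := by ring

theorem throughputHasOrder_of_long_range {a δ : ℝ} (ha : 0 < a) (hδ₀ : 0 ≤ δ)
    (hδ : δ < √3 / 2 * a) {ch : Channel} (hgain : 0 < ch.gain) (hT : 0 < ch.threshold)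
    (hη : 0 < ch.noise) (hα : 0 ≤ ch.pathLoss) {r : ℕ → ℕ} {K : ℝ} (hK : 0 < K)
    (hr : ∀ᶠ L in atTop, 1 ≤ r L ∧ r L ≤ L) (hLK : ∀ᶠ L : ℕ in atTop, (L : ℝ) ≤ K * r L) :
    ThroughputHasOrder.{u} a δ ch r (fun n => 1 / n) := by
  have hκ : 0 < (√3 * a - 2 * δ) / 2 := by linarith
  have hβ : 0 < 2 * √3 * a := by positivity
  generalize hκe : (√3 * a - 2 * δ) / 2 = κ at *
  generalize hβe : 2 * √3 * a = β at *
  have hlog2 := Real.log_pos one_lt_two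
  have hn : ∀ L, (0 : ℝ) < numNodes L := by
    intro L
    have : 0 < numNodes L := lt_of_lt_of_le (by positivity) (sq_le_numNodes L)
    exact_mod_cast this
  set E := (8 * K + 2) ^ 2 * ((Real.log (1 + ch.threshold * (β / κ) ^ ch.pathLoss / ch.noise) +
          ch.pathLoss) / Real.log 2) +
        ch.threshold * (2 * β / κ) ^ ch.pathLoss /
          min ch.noise (ch.threshold * (κ / (2 * β * K)) ^ ch.pathLoss) / Real.log 2 with hE
  have hE0 : 0 ≤ E := by
    have : 0 ≤ Real.log (1 + ch.threshold * (β / κ) ^ ch.pathLoss / ch.noise) :=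
      Real.log_nonneg (le_add_of_nonneg_right (by positivity))
    positivity
  have hrate : 0 < Real.logb 2 (1 + ch.threshold / ch.noise) :=
    Real.logb_pos one_lt_two (lt_add_of_pos_right _ (by positivity))
  refine throughputHasOrder_of_bounds ha hδ₀ hδ hgain hT hη
    (c := Real.logb 2 (1 + ch.threshold / ch.noise) / (4 * K + 4))
    (B := E) ?_ (by positivity) hE0 ?_ ?_
  · exact Eventually.of_forall fun L => one_div_pos.2 (hn L)
  · filter_upwards [hr, hLK] with L hrL hKL W hW X hX d _
    rw [hκe, hβe] at hX
    refine (hX.achievable_of_long_range hκ hgain hT hη hα hW.le hrL.1 hKL d).mono (le_of_eq ?_)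
    have := hn L
    field_simp
  · filter_upwards [hr, hLK] with L hrL hKL W hW X hX S hS t
    rw [hκe, hβe] at hX
    refine (hX.progress_le_of_long_range hκ hβ hgain hT hη hα hW.le hK hrL.1 hrL.2 hKL hS t).trans
      ?_
    rw [← hE]
    have h2 : (r L : ℝ) ≤ L := by exact_mod_cast hrL.2
    have := hn L
    calc E * (W * r L) ≤ E * (W * L) := by gcongr
      _ = _ := by field_simp

end HexMesh

theorem theorem1 (a δ : ℝ) (ha : 0 < a) (hδ₀ : 0 ≤ δ) (hδ : δ < √3 / 2 * a)
    (ch : HexMesh.Channel) (hgain : 0 < ch.gain) (hthreshold : 0 < ch.threshold)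
    (hnoise : 0 < ch.noise)
    (r : ℕ → ℕ) (hr : ∀ᶠ L in atTop, 1 ≤ r L ∧ r L ≤ L) :
    (2 < ch.pathLoss →
      (fun L => (r L : ℝ)) =Θ[atTop] (fun _ => (1 : ℝ)) →
      HexMesh.ThroughputHasOrder.{u} a δ ch r (fun n => 1 / √n)) ∧
    (2 ≤ ch.pathLoss →
      (fun L => (r L : ℝ)) =Θ[atTop] (fun L => √(HexMesh.numNodes L : ℝ)) →
      HexMesh.ThroughputHasOrder.{u} a δ ch r (fun n => 1 / n)) := by
  constructor
  · intro hα hΘ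
    -- The upper half of Θ gives a uniform bound ρ on r; `1 ≤ r L` supplies the lower side.
    obtain ⟨C, hC⟩ := hΘ.1.bound
    refine HexMesh.throughputHasOrder_of_short_range ha hδ₀ hδ hgain hthreshold hnoise hα
      (ρ := ⌈C⌉₊) ?_
    filter_upwards [hr, hC] with L hL hCL
    refine ⟨hL.1, ?_⟩
    rw [Real.norm_natCast, norm_one, mul_one] at hCL
    exact_mod_cast hCL.trans (Nat.le_ceil C)
  · intro hα hΘ
    -- The lower half of Θ, with L ≤ √n, gives L ≤ K·r; `r L ≤ L` supplies the upper side.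
    obtain ⟨K, hK, hKb⟩ := hΘ.2.exists_pos
    refine HexMesh.throughputHasOrder_of_long_range ha hδ₀ hδ hgain hthreshold hnoise
      (by linarith) hK hr ?_
    filter_upwards [hKb.bound] with L hL
    rw [Real.norm_of_nonneg (Real.sqrt_nonneg _), Real.norm_natCast] at hL
    exact (HexMesh.le_sqrt_numNodes L).trans hL
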